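/- **Proposition 2.6 (prop-sy).** Write $r=\sqrt{x_1^2+x_2^2}$, $z=x_3$, and let $(e_r,e_\theta,e_z)$ be the cylindrical frame of $\mathbb R^3$. Let $1\le p\le\infty$ and $1\le q<3$. Let $u\in L^p(\mathbb R^3;\mathbb R^3)$ be a divergence free axisymmetric vector field without swirl ($u=u^r(r,z)e_r+u^z(r,z)e_z$) whose curl $\omega=\operatorname{curl}u$ is locally integrable (derivatives being taken in the sense of distributions), let $\omega_\theta=\omega\cdot e_\theta$, and suppose that $\frac{\omega_\theta}{r}\in L^q(\mathbb R^3)$. (For example, $u\in H^1$ with $\frac{\omega_\theta}{r}\in L^2$.) Then for almost every $x\in\mathbb R^3$ the following convolution integrals converge absolutely at $x$ and $$ \frac{u^{r}}{r}=(c_{1}+2\gamma_{1}i)\,\frac{x_{3}}{|x|^{3}}\ast\frac{\omega_\theta}{r}-6\gamma_{1}i\,\frac{x_{2}^{2}}{r^{2}}\,\Big(\frac{x_{1}^{2}x_{3}}{|x|^{5}}\ast\frac{\omega_\theta}{r}\Big)-6\gamma_{1}i\,\frac{x_{1}^{2}}{r^{2}}\,\Big(\frac{x_{2}^{2}x_{3}}{|x|^{5}}\ast\frac{\omega_\theta}{r}\Big)+12\gamma_{1}i\,\frac{x_{1}x_{2}}{r^{2}}\,\Big(\frac{x_{1}x_{2}x_{3}}{|x|^{5}}\ast\frac{\omega_\theta}{r}\Big),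 $$ where $\ast$ is convolution with respect to Lebesgue measure on $\mathbb R^3$ and $$ c_1=\frac{1}{(2\pi)^3}\,2\pi^{\frac32}\frac{\Gamma(\frac12)}{\Gamma(1)}=\frac1{4\pi},\qquad \gamma_1=\frac{1}{(2\pi)^3}\,i\,\pi^{\frac32}\frac{\Gamma(\frac12)}{\Gamma(2)}=\frac{i}{8\pi} $$ (so that $c_1+2\gamma_1 i=0$ and $-6\gamma_1 i=\frac{3}{4\pi}$). Moreover, there is a universal constant $C>0$, independent of $u,p,q$, such that for almost every $x$ the integral defining $\frac{1}{|x|^{2}}\ast\big|\frac{\omega_\theta}{r}\big|$ converges and $$ \Big|\frac{u^{r}}{r}\Big|\le C\,\frac{1}{|x|^{2}}\ast\Big|\frac{\omega_\theta}{r}\Big| . $$ If in addition $u\in C^1(\mathbb R^3)$, then the formula and the bound hold at every $x$ with $r\neq0$. -/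

import Mathlib

open MeasureTheory
open scoped ENNReal

namespace AxisymFlow

noncomputable section

/-- Three-dimensional Euclidean space; the coordinates `x₁, x₂, x₃` are `x 0, x 1, x 2`. -/
abbrev E3 : Type := EuclideanSpace ℝ (Fin 3)

/-- The distance `r` to the vertical axis. -/
def rad (x : E3) : ℝ := Real.sqrt (x 0 ^ 2 + x 1 ^ 2)

/-- The radial unit vector `e_r` of the cylindrical frame (the value on the axis is irrelevant). -/
def eR (x : E3) : E3 := !₂[x 0 / rad x, x 1 / rad x, 0]

/-- The angular unit vector `e_θ` of the cylindrical frame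
(the value on the axis is irrelevant). -/
def eTheta (x : E3) : E3 := !₂[-(x 1) / rad x, x 0 / rad x, 0]

/-- The rotation of angle `α` about the vertical axis. -/
def rot (α : ℝ) (x : E3) : E3 :=
  !₂[Real.cos α * x 0 - Real.sin α * x 1, Real.sin α * x 0 + Real.cos α * x 1, x 2]

/-- `u` is axisymmetric: `R_{-α} (u (R_α x)) = u x` for every angle `α`
(fields are considered up to null sets). -/
def IsAxisymmetric (u : E3 → E3) : Prop :=
  ∀ α : ℝ, ∀ᵐ x ∂(volume : Measure E3), rot (-α) (u (rot α x)) = u x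

/-- `u` has no swirl: its angular component vanishes. -/
def NoSwirl (u : E3 → E3) : Prop :=
  ∀ᵐ x ∂(volume : Measure E3), inner ℝ (u x) (eTheta x) = 0

/-- The partial derivative `∂ᵢ f`. -/
def pd (i : Fin 3) (f : E3 → ℝ) (x : E3) : ℝ := fderiv ℝ f x (EuclideanSpace.single i 1)

/-- The classical curl of a (differentiable) vector field. -/
def curl (v : E3 → E3) (x : E3) : E3 :=
  !₂[pd 1 (fun y => v y 2) x - pd 2 (fun y => v y 1) x,
     pd 2 (fun y => v y 0) x - pd 0 (fun y => v y 2) x,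
     pd 0 (fun y => v y 1) x - pd 1 (fun y => v y 0) x]

/-- `div u = 0` in the sense of distributions. -/
def WeakDivFree (u : E3 → E3) : Prop :=
  ∀ φ : E3 → ℝ, ContDiff ℝ (⊤ : ℕ∞) φ → HasCompactSupport φ →
    ∫ x : E3, fderiv ℝ φ x (u x) = 0

/-- The locally integrable field `ω` is `curl u` in the sense of distributions. -/
def IsWeakCurl (u ω : E3 → E3) : Prop :=
  LocallyIntegrable ω (volume : Measure E3) ∧
    ∀ ψ : E3 → E3, ContDiff ℝ (⊤ : ℕ∞) ψ → HasCompactSupport ψ →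
      ∫ x : E3, inner ℝ (u x) (curl ψ x) = ∫ x : E3, inner ℝ (ω x) (ψ x)

/-- The function `u^r / r`, where `u^r = u · e_r`. -/
def urOverR (u : E3 → E3) (x : E3) : ℝ := inner ℝ (u x) (eR x) / rad x

/-- The function `ω_θ / r`, where `ω_θ = ω · e_θ`. -/
def omegaOverR (ω : E3 → E3) (x : E3) : ℝ := inner ℝ (ω x) (eTheta x) / rad x

/-- The kernel `x₃ / |x|³`. -/
def ker0 (x : E3) : ℝ := x 2 / ‖x‖ ^ 3

/-- The kernel `xᵢ xⱼ x₃ / |x|⁵`. -/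
def ker (i j : Fin 3) (x : E3) : ℝ := x i * x j * x 2 / ‖x‖ ^ 5

/-- The kernel `1 / |x|²`. -/
def kerSY (x : E3) : ℝ := 1 / ‖x‖ ^ 2

/-- Convolution with respect to Lebesgue measure: `∫ K(y) f(x - y) dy`. -/
def conv (K f : E3 → ℝ) (x : E3) : ℝ :=
  convolution K f (ContinuousLinearMap.mul ℝ ℝ) (volume : Measure E3) x

/-- The integral defining `conv K f x` converges absolutely. -/
def ConvExists (K f : E3 → ℝ) (x : E3) : Prop :=
  ConvolutionExistsAt K f x (ContinuousLinearMap.mul ℝ ℝ) (volume : Measure E3)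

/-- The constant of `F⁻¹(|ξ|⁻²) = c₁ / |x|`, with `F⁻¹ g (x) = (2π)⁻³ ∫ e^{i x·ξ} g(ξ) dξ`. -/
def c1 : ℂ :=
  (((2 * Real.pi) ^ 3)⁻¹ * (2 * Real.pi ^ (3 / 2 : ℝ) * Real.Gamma (1 / 2) / Real.Gamma 1) : ℝ)

/-- The constant of `F⁻¹(ξ_k |ξ|⁻⁴) = γ₁ x_k / |x|`, with the same Fourier normalization. -/
def gamma1 : ℂ :=
  Complex.I *
    (((2 * Real.pi) ^ 3)⁻¹ * (Real.pi ^ (3 / 2 : ℝ) * Real.Gamma (1 / 2) / Real.Gamma 2) : ℝ)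

/-- The convolution formula for `u^r / r` at the point `x`, including the absolute convergence
of the four convolution integrals. -/
def FormulaAt (u ω : E3 → E3) (x : E3) : Prop :=
  ConvExists ker0 (omegaOverR ω) x ∧ ConvExists (ker 0 0) (omegaOverR ω) x ∧
  ConvExists (ker 1 1) (omegaOverR ω) x ∧ ConvExists (ker 0 1) (omegaOverR ω) x ∧
  (urOverR u x : ℂ) =
    (c1 + 2 * gamma1 * Complex.I) * (conv ker0 (omegaOverR ω) x : ℂ)
    - 6 * gamma1 * Complex.I
        * ((x 1 ^ 2 / rad x ^ 2 * conv (ker 0 0) (omegaOverR ω) x : ℝ) : ℂ)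
    - 6 * gamma1 * Complex.I
        * ((x 0 ^ 2 / rad x ^ 2 * conv (ker 1 1) (omegaOverR ω) x : ℝ) : ℂ)
    + 12 * gamma1 * Complex.I
        * ((x 0 * x 1 / rad x ^ 2 * conv (ker 0 1) (omegaOverR ω) x : ℝ) : ℂ)

/-- The pointwise bound `|u^r / r| ≤ C |x|⁻² ∗ |ω_θ / r|` at the point `x`, including the
absolute convergence of the convolution integral. -/
def SYBoundAt (C : ℝ) (u ω : E3 → E3) (x : E3) : Prop :=
  ConvExists kerSY (fun y => |omegaOverR ω y|) x ∧
  |urOverR u x| ≤ C * conv kerSY (fun y => |omegaOverR ω y|) x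

end

end AxisymFlow

open AxisymFlow

/-!
For an axisymmetric field without swirl write `g = u^r / r` and `f = ω_θ / r`. Formally
`-Δ u_h = -∂₃ (f y_h)` for the horizontal part `u_h = g y_h`, so `u_h` is the convolution of
`x₃ / (4π |x|³)` with `f y_h`; but for `q ≥ 3/2` this integral need not converge. Contracting with
the horizontal part `x_h` of the point of evaluation and integrating by parts in the angle of `y`
produces the absolutely convergent representation

  `x_h · u_h (x) = 3 / (4π) ∫ f(y) (x₃ - y₃) (x₂ y₁ - x₁ y₂)² / |x - y|⁵ dy`,

whose kernel is at most `r² / |x - y|²`. Expanding the square gives the three kernels of the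
statement (the coefficient `c₁ + 2 γ₁ i` of the fourth one is zero), and the bound on the kernel
gives the pointwise estimate with `C = 3 / (4π)`.

To prove the representation at a fixed `x`, the weak equations are tested against
`2 Φ'(|y - x|²) (y - x) × x_h` and `2 Φ'(|y - x|²) (y - x) · x_h` with `Φ` smooth and compactly
supported (`integral_hdot_eq_of_weakCurl`). The weak curl of `u` is again axisymmetric
(`IsWeakCurl.isAxisymmetric`), and rotation invariant functions are orthogonal to angular
derivatives (`integral_mul_eq_zero_of_rot_invariant`); this removes `ω_r` and `ω_z` and performs
the integration by parts (`integral_hdot_eq_integral_omegaOverR`). For `Φ` one takes the difference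
of two rescalings, at scales `ε → 0` and `R → ∞`, of a smooth profile equal to `1 / (4π √t)` for
`t ≥ 1`. Then `-Δ Φ(|y - x|²)` is a difference of two mollifiers. The fine one recovers `u` at its
Lebesgue points (`tendsto_integral_bump_near`). The coarse one tends to zero, also for `p = ∞`,
after another integration by parts in the angle (`tendsto_integral_bump_far`). The right-hand side
converges by dominated convergence wherever `|x|⁻² ∗ |f|` does: almost everywhere since `q < 3`
(`integrableOn_compl_ball`, `ae_integrableOn_ball`), and at every point off the axis if `u` is
`C¹`, because `f` is then locally bounded there (`exists_ae_bound_omegaOverR`).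
-/

namespace AxisymFlow

open Filter Topology

/-! ### Coordinates, rotations and the axis -/

lemma rad_sq (x : E3) : rad x ^ 2 = x 0 ^ 2 + x 1 ^ 2 := Real.sq_sqrt (by positivity)

lemma rad_nonneg (x : E3) : 0 ≤ rad x := Real.sqrt_nonneg _

lemma continuous_rad : Continuous rad := by unfold rad; fun_prop

lemma inner_eq (a b : E3) : inner ℝ a b = a 0 * b 0 + a 1 * b 1 + a 2 * b 2 := by
  simp [PiLp.inner_apply, Fin.sum_univ_three]; ring

lemma norm_sq_eq (a : E3) : ‖a‖ ^ 2 = a 0 ^ 2 + a 1 ^ 2 + a 2 ^ 2 := by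
  rw [EuclideanSpace.real_norm_sq_eq, Fin.sum_univ_three]

lemma rad_le_norm (x : E3) : rad x ≤ ‖x‖ := by
  refine abs_le_of_sq_le_sq' ?_ (norm_nonneg x) |>.2
  rw [rad_sq, norm_sq_eq]; nlinarith [sq_nonneg (x 2)]

lemma abs_coord_le (x : E3) (i : Fin 3) : |x i| ≤ ‖x‖ := by
  simpa using PiLp.norm_apply_le x i

@[simp] lemma rot_zero_coord (α : ℝ) (x : E3) :
    rot α x 0 = Real.cos α * x 0 - Real.sin α * x 1 := rfl
@[simp] lemma rot_one_coord (α : ℝ) (x : E3) :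
    rot α x 1 = Real.sin α * x 0 + Real.cos α * x 1 := rfl
@[simp] lemma rot_two_coord (α : ℝ) (x : E3) : rot α x 2 = x 2 := rfl

lemma ext3 {a b : E3} (h0 : a 0 = b 0) (h1 : a 1 = b 1) (h2 : a 2 = b 2) : a = b := by
  ext i; fin_cases i <;> assumption

lemma rot_neg_rot (α : ℝ) (x : E3) : rot (-α) (rot α x) = x := by
  have h := Real.sin_sq_add_cos_sq α
  apply ext3 <;> simp
  · linear_combination (x 0) * h
  · linear_combination (x 1) * h

lemma rot_rot_neg (α : ℝ) (x : E3) : rot α (rot (-α) x) = x := by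
  simpa using rot_neg_rot (-α) x

lemma inner_rot_rot (α : ℝ) (a b : E3) : inner ℝ (rot α a) (rot α b) = inner ℝ a b := by
  have h := Real.sin_sq_add_cos_sq α
  simp only [inner_eq, rot_zero_coord, rot_one_coord, rot_two_coord]
  linear_combination (a 0 * b 0 + a 1 * b 1) * h

@[simp] lemma rad_rot (α : ℝ) (x : E3) : rad (rot α x) = rad x := by
  have h := Real.sin_sq_add_cos_sq α
  unfold rad
  congr 1
  simp only [rot_zero_coord, rot_one_coord]
  linear_combination (x 0 ^ 2 + x 1 ^ 2) * h

/-- The rotation `rot α` as a linear isometry. -/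
noncomputable def rotIso (α : ℝ) : E3 ≃ₗᵢ[ℝ] E3 where
  toFun := rot α
  invFun := rot (-α)
  left_inv := rot_neg_rot α
  right_inv := rot_rot_neg α
  map_add' x y := by apply ext3 <;> simp <;> ring
  map_smul' c x := by apply ext3 <;> simp <;> ring
  norm_map' x := by
    have h : ‖rot α x‖ ^ 2 = ‖x‖ ^ 2 := by
      rw [← real_inner_self_eq_norm_sq, ← real_inner_self_eq_norm_sq, inner_rot_rot]
    exact (sq_eq_sq₀ (norm_nonneg _) (norm_nonneg _)).1 h

@[simp] lemma coe_rotIso (α : ℝ) : ⇑(rotIso α) = rot α := rfl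

lemma measurePreserving_rot (α : ℝ) : MeasurePreserving (rot α) (volume : Measure E3) volume :=
  (rotIso α).measurePreserving

lemma measurableEmbedding_rot (α : ℝ) : MeasurableEmbedding (rot α) :=
  (rotIso α).toHomeomorph.measurableEmbedding

lemma integral_comp_rot (α : ℝ) (F : E3 → ℝ) : ∫ x, F (rot α x) = ∫ x, F x :=
  (measurePreserving_rot α).integral_comp (measurableEmbedding_rot α) F

lemma continuous_rot_uncurry : Continuous fun p : ℝ × E3 => rot p.1 p.2 := by
  unfold rot
  refine (PiLp.continuous_toLp 2 _).comp (continuous_pi fun i => ?_)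
  fin_cases i <;> simp <;> fun_prop

lemma continuous_rot_left (y : E3) : Continuous fun α : ℝ => rot α y := by
  unfold rot
  refine (PiLp.continuous_toLp 2 _).comp (continuous_pi fun i => ?_)
  fin_cases i <;> simp <;> fun_prop

lemma ae_rad_pos : ∀ᵐ x ∂(volume : Measure E3), 0 < rad x := by
  have h0 : (volume : Measure E3) (LinearMap.ker (EuclideanSpace.proj (𝕜 := ℝ) (0 : Fin 3) :
      E3 →L[ℝ] ℝ).toLinearMap : Submodule ℝ E3) = 0 := by
    apply Measure.addHaar_submodule
    intro h
    have : (EuclideanSpace.single 0 1 : E3) ∈ (⊤ : Submodule ℝ E3) := trivial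
    rw [← h] at this
    simp at this
  rw [ae_iff]
  refine measure_mono_null (fun x hx => ?_) h0
  have hx' : rad x = 0 := le_antisymm (not_lt.1 hx) (rad_nonneg x)
  have := rad_sq x
  rw [hx'] at this
  simp only [SetLike.mem_coe, LinearMap.mem_ker]
  change x 0 = 0
  nlinarith [sq_nonneg (x 0), sq_nonneg (x 1)]

lemma inner_eTheta (v y : E3) : inner ℝ v (eTheta y) = (y 0 * v 1 - y 1 * v 0) / rad y := by
  simp [inner_eq, eTheta]; ring

lemma inner_eR (v y : E3) : inner ℝ v (eR y) = (y 0 * v 0 + y 1 * v 1) / rad y := by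
  simp [inner_eq, eR]; ring

lemma omegaOverR_eq (ω : E3 → E3) (y : E3) :
    omegaOverR ω y = (y 0 * ω y 1 - y 1 * ω y 0) / rad y ^ 2 := by
  rw [omegaOverR, inner_eTheta, div_div, sq]

lemma urOverR_eq (u : E3 → E3) (y : E3) :
    urOverR u y = (y 0 * u y 0 + y 1 * u y 1) / rad y ^ 2 := by
  rw [urOverR, inner_eR, div_div, sq]

/-! ### Angular averages -/

/-- A rotation invariant function is orthogonal to every angular derivative `G = ∂_θ H`:
average over the circle before integrating in space. -/
lemma integral_mul_eq_zero_of_rot_invariant {F G H : E3 → ℝ}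
    (hF : ∀ α : ℝ, ∀ᵐ y ∂(volume : Measure E3), F (rot α y) = F y)
    (hFm : AEStronglyMeasurable F (volume : Measure E3))
    (hG : Continuous G) (hFG : Integrable (fun y => F y * G y) (volume : Measure E3))
    (hH : ∀ (y : E3) (α : ℝ), HasDerivAt (fun β => H (rot β y)) (G (rot α y)) α) :
    ∫ y, F y * G y = 0 := by
  have hrot : ∀ α : ℝ, (fun y => F y * G (rot α y)) =ᵐ[volume]
      fun y => F (rot α y) * G (rot α y) := fun α => by
    filter_upwards [hF α] with y hy
    rw [hy]
  have hcirc : ∀ y : E3, ∫ α in Set.Ioc 0 (2 * Real.pi), G (rot α y) = 0 := by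
    intro y
    have hc : Continuous fun α : ℝ => G (rot α y) := hG.comp (continuous_rot_left y)
    have hftc : ∫ α in (0 : ℝ)..(2 * Real.pi), G (rot α y) =
        H (rot (2 * Real.pi) y) - H (rot 0 y) :=
      intervalIntegral.integral_eq_sub_of_hasDerivAt (f := fun β => H (rot β y))
        (fun α _ => hH y α) (hc.intervalIntegrable _ _)
    rw [← intervalIntegral.integral_of_le (by positivity), hftc]
    have hper : rot (2 * Real.pi) y = rot 0 y := by apply ext3 <;> simp
    rw [hper, sub_self]
  set μ : Measure ℝ := volume.restrict (Set.Ioc 0 (2 * Real.pi)) with hμ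
  have hm : AEStronglyMeasurable (fun p : ℝ × E3 => F p.2 * G (rot p.1 p.2))
      (μ.prod volume) :=
    hFm.comp_snd.mul (hG.comp continuous_rot_uncurry).aestronglyMeasurable
  have hslice : ∀ α : ℝ, Integrable (fun y => F y * G (rot α y)) (volume : Measure E3) :=
    fun α => ((measurePreserving_rot α).integrable_comp_of_integrable hFG).congr (hrot α).symm
  have hint : Integrable (fun p : ℝ × E3 => F p.2 * G (rot p.1 p.2)) (μ.prod volume) := by
    rw [integrable_prod_iff hm]
    refine ⟨Filter.Eventually.of_forall hslice, ?_⟩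
    have : (fun α : ℝ => ∫ y : E3, ‖F y * G (rot α y)‖) = fun _ => ∫ y : E3, ‖F y * G y‖ := by
      funext α
      rw [← integral_comp_rot α fun y => ‖F y * G y‖]
      exact integral_congr_ae ((hrot α).fun_comp norm)
    simp only [this]
    exact integrable_const _
  have hswap := integral_integral_swap (f := fun (α : ℝ) (y : E3) => F y * G (rot α y)) hint
  have h1 : ∀ α : ℝ, ∫ y, F y * G (rot α y) = ∫ y, F y * G y := fun α => by
    rw [← integral_comp_rot α fun y => F y * G y]
    exact integral_congr_ae (hrot α)
  simp only [h1, integral_const_mul, hcirc, mul_zero, integral_zero, integral_const,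
    smul_eq_mul] at hswap
  have hpos : 0 < μ.real Set.univ := by
    simp [hμ, Measure.real, ENNReal.toReal_ofReal Real.pi_pos.le, Real.pi_pos]
  exact (mul_eq_zero.1 hswap).resolve_left hpos.ne'

/-! ### Axial symmetry of the vorticity -/

lemma pd_eq_of_hasFDerivAt {f : E3 → ℝ} {f' : E3 →L[ℝ] ℝ} {x : E3} (h : HasFDerivAt f f' x)
    (i : Fin 3) : pd i f x = f' (EuclideanSpace.single i 1) := by rw [pd, h.fderiv]

lemma pd_lin {f g : E3 → ℝ} {x : E3} (hf : DifferentiableAt ℝ f x)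
    (hg : DifferentiableAt ℝ g x) (a b : ℝ) (i : Fin 3) :
    pd i (fun y => a * f y + b * g y) x = a * pd i f x + b * pd i g x := by
  have h : HasFDerivAt (fun y => a * f y + b * g y) (a • fderiv ℝ f x + b • fderiv ℝ g x) x :=
    (hf.hasFDerivAt.const_mul a).add (hg.hasFDerivAt.const_mul b)
  rw [pd_eq_of_hasFDerivAt h]
  simp [pd]

lemma pd_comp_rot {g : E3 → ℝ} (β : ℝ) {y : E3} (hg : DifferentiableAt ℝ g (rot β y))
    (i : Fin 3) :
    pd i (fun z => g (rot β z)) y = fderiv ℝ g (rot β y) (rot β (EuclideanSpace.single i 1)) := by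
  have h1 : HasFDerivAt (rot β) ((rotIso β).toContinuousLinearEquiv : E3 →L[ℝ] E3) y :=
    (rotIso β).toContinuousLinearEquiv.hasFDerivAt
  have h2 : HasFDerivAt (fun z => g (rot β z)) _ y := hg.hasFDerivAt.comp y h1
  rw [pd_eq_of_hasFDerivAt h2]
  simp

lemma rot_single_zero (β : ℝ) : rot β (EuclideanSpace.single 0 1) =
    Real.cos β • EuclideanSpace.single 0 1 + Real.sin β • EuclideanSpace.single 1 1 := by
  apply ext3 <;> simp

lemma rot_single_one (β : ℝ) : rot β (EuclideanSpace.single 1 1) =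
    (-Real.sin β) • EuclideanSpace.single 0 1 + Real.cos β • EuclideanSpace.single 1 1 := by
  apply ext3 <;> simp

lemma rot_single_two (β : ℝ) : rot β (EuclideanSpace.single 2 1) = EuclideanSpace.single 2 1 := by
  apply ext3 <;> simp

lemma pd_zero_comp_rot {g : E3 → ℝ} (β : ℝ) {y : E3} (hg : DifferentiableAt ℝ g (rot β y)) :
    pd 0 (fun z => g (rot β z)) y =
      Real.cos β * pd 0 g (rot β y) + Real.sin β * pd 1 g (rot β y) := by
  rw [pd_comp_rot β hg, rot_single_zero]; simp [pd]

lemma pd_one_comp_rot {g : E3 → ℝ} (β : ℝ) {y : E3} (hg : DifferentiableAt ℝ g (rot β y)) :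
    pd 1 (fun z => g (rot β z)) y =
      -Real.sin β * pd 0 g (rot β y) + Real.cos β * pd 1 g (rot β y) := by
  rw [pd_comp_rot β hg, rot_single_one]; simp [pd]

lemma pd_two_comp_rot {g : E3 → ℝ} (β : ℝ) {y : E3} (hg : DifferentiableAt ℝ g (rot β y)) :
    pd 2 (fun z => g (rot β z)) y = pd 2 g (rot β y) := by
  rw [pd_comp_rot β hg, rot_single_two]; simp [pd]

lemma curl_rot_conj {ψ : E3 → E3} (hψ : Differentiable ℝ ψ) (α : ℝ) (y : E3) :
    curl (fun z => rot α (ψ (rot (-α) z))) y = rot α (curl ψ (rot (-α) y)) := by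
  have hd : ∀ i, Differentiable ℝ fun z => ψ z i := fun i => by fun_prop
  have hr : Differentiable ℝ (rot (-α)) := fun z =>
    (rotIso (-α)).toContinuousLinearEquiv.differentiableAt
  have hc : ∀ i, Differentiable ℝ fun z => ψ (rot (-α) z) i := fun i => (hd i).comp hr
  have e0 : (fun z => rot α (ψ (rot (-α) z)) 0) = fun z =>
      Real.cos α * ψ (rot (-α) z) 0 + (-Real.sin α) * ψ (rot (-α) z) 1 := by
    funext z; simp only [rot_zero_coord]; ring
  have e1 : (fun z => rot α (ψ (rot (-α) z)) 1) = fun z =>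
      Real.sin α * ψ (rot (-α) z) 0 + Real.cos α * ψ (rot (-α) z) 1 := by
    funext z; simp only [rot_one_coord]
  have e2 : (fun z => rot α (ψ (rot (-α) z)) 2) = fun z => ψ (rot (-α) z) 2 := rfl
  have h := Real.sin_sq_add_cos_sq α
  have p0 := fun i => pd_zero_comp_rot (-α) (hd i (rot (-α) y))
  have p1 := fun i => pd_one_comp_rot (-α) (hd i (rot (-α) y))
  have p2 := fun i => pd_two_comp_rot (-α) (hd i (rot (-α) y))
  simp only [Real.cos_neg, Real.sin_neg] at p0 p1 p2
  have q0 : ∀ i, pd i (fun z => rot α (ψ (rot (-α) z)) 0) y = _ := fun i =>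
    (congrArg (fun F => pd i F y) e0).trans (pd_lin (hc 0 y) (hc 1 y) _ _ i)
  have q1 : ∀ i, pd i (fun z => rot α (ψ (rot (-α) z)) 1) y = _ := fun i =>
    (congrArg (fun F => pd i F y) e1).trans (pd_lin (hc 0 y) (hc 1 y) _ _ i)
  apply ext3
  · change pd 1 _ y - pd 2 _ y = Real.cos α * (pd 1 _ _ - pd 2 _ _) -
      Real.sin α * (pd 2 _ _ - pd 0 _ _)
    rw [q1, e2, p1, p2, p2]; ring
  · change pd 2 _ y - pd 0 _ y = Real.sin α * (pd 1 _ _ - pd 2 _ _) +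
      Real.cos α * (pd 2 _ _ - pd 0 _ _)
    rw [q0, e2, p0, p2, p2]; ring
  · change pd 0 _ y - pd 1 _ y = pd 0 _ _ - pd 1 _ _
    rw [q0, q1, p0, p0, p1, p1]
    linear_combination
      (pd 0 (fun z => ψ z 1) (rot (-α) y) - pd 1 (fun z => ψ z 0) (rot (-α) y)) * h

lemma locallyIntegrable_coord {ω : E3 → E3} (hω : LocallyIntegrable ω volume) (i : Fin 3) :
    LocallyIntegrable (fun x => ω x i) volume := fun x => by
  obtain ⟨s, hs, h⟩ := hω x
  exact ⟨s, hs, (EuclideanSpace.proj (𝕜 := ℝ) i : E3 →L[ℝ] ℝ).integrable_comp h⟩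

lemma ae_eq_of_integral_inner_eq {ω ω' : E3 → E3} (hω : LocallyIntegrable ω volume)
    (hω' : LocallyIntegrable ω' volume)
    (h : ∀ ψ : E3 → E3, ContDiff ℝ (⊤ : ℕ∞) ψ → HasCompactSupport ψ →
      ∫ x, inner ℝ (ω x) (ψ x) = ∫ x, inner ℝ (ω' x) (ψ x)) :
    ω =ᵐ[volume] ω' := by
  have key : ∀ i : Fin 3, ∀ᵐ x ∂(volume : Measure E3), ω x i = ω' x i := fun i => by
    refine ae_eq_of_integral_contDiff_smul_eq (locallyIntegrable_coord hω i)
      (locallyIntegrable_coord hω' i) fun g hg hgc => ?_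
    have := h (fun x => g x • EuclideanSpace.single i 1) (hg.smul contDiff_const)
      (hgc.smul_right)
    simpa [inner_smul_right, EuclideanSpace.inner_single_right] using this
  filter_upwards [key 0, key 1, key 2] with x h0 h1 h2
  exact ext3 h0 h1 h2

lemma inner_rot_left (α : ℝ) (a b : E3) : inner ℝ (rot α a) b = inner ℝ a (rot (-α) b) := by
  rw [← inner_rot_rot (-α), rot_neg_rot]

lemma IsAxisymmetric.apply_rot {u : E3 → E3} (hu : IsAxisymmetric u) (α : ℝ) :
    ∀ᵐ y ∂(volume : Measure E3), u (rot α y) = rot α (u y) := by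
  filter_upwards [hu α] with y hy
  rw [← hy, rot_rot_neg]

lemma locallyIntegrable_rot_conj {ω : E3 → E3} (hω : LocallyIntegrable ω volume)
    (α : ℝ) : LocallyIntegrable (fun y => rot (-α) (ω (rot α y))) volume := by
  rw [locallyIntegrable_iff]
  intro k hk
  have h1 : IntegrableOn ω (rot α '' k) volume :=
    hω.integrableOn_isCompact (hk.image (rotIso α).continuous)
  have h2 : IntegrableOn (fun y => ω (rot α y)) k volume :=
    ((measurePreserving_rot α).integrableOn_image (measurableEmbedding_rot α)).1 h1
  exact ((rotIso (-α)).toContinuousLinearEquiv : E3 →L[ℝ] E3).integrable_comp h2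

/-- Rotating the test field transfers the symmetry of `u` to `ω`, since the curl commutes with
rotations about the axis and the weak curl is unique. -/
lemma IsWeakCurl.isAxisymmetric {u ω : E3 → E3} (hu : IsAxisymmetric u) (h : IsWeakCurl u ω) :
    IsAxisymmetric ω := by
  intro α
  refine ae_eq_of_integral_inner_eq (locallyIntegrable_rot_conj h.1 α) h.1
    fun ψ hψ hψc => ?_
  set χ : E3 → E3 := fun z => rot α (ψ (rot (-α) z)) with hχ
  have hχs : ContDiff ℝ (⊤ : ℕ∞) χ :=
    (rotIso α).toContinuousLinearEquiv.contDiff.comp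
      (hψ.comp (rotIso (-α)).toContinuousLinearEquiv.contDiff)
  have hχc : HasCompactSupport χ := by
    have h1 : HasCompactSupport fun z => ψ (rot (-α) z) :=
      hψc.comp_homeomorph (rotIso (-α)).toHomeomorph
    exact h1.comp_left (g := rot α) (map_zero (rotIso α))
  have hdψ : Differentiable ℝ ψ := hψ.differentiable (by simp)
  calc ∫ x, inner ℝ (rot (-α) (ω (rot α x))) (ψ x)
      = ∫ x, inner ℝ (ω (rot α x)) (χ (rot α x)) := by
        simp only [inner_rot_left, neg_neg, hχ, rot_neg_rot]
    _ = ∫ x, inner ℝ (ω x) (χ x) := integral_comp_rot α fun x => inner ℝ (ω x) (χ x)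
    _ = ∫ x, inner ℝ (u x) (curl χ x) := (h.2 χ hχs hχc).symm
    _ = ∫ x, inner ℝ (u (rot α x)) (curl χ (rot α x)) :=
        (integral_comp_rot α fun x => inner ℝ (u x) (curl χ x)).symm
    _ = ∫ x, inner ℝ (u x) (curl ψ x) := by
        refine integral_congr_ae ?_
        filter_upwards [hu.apply_rot α] with x hx
        rw [hx, hχ, curl_rot_conj hdψ, rot_neg_rot, inner_rot_rot]
    _ = ∫ x, inner ℝ (ω x) (ψ x) := h.2 ψ hψ hψc

/-- For an axisymmetric field `v`, the function `v · y_h / r²`, with `y_h` the horizontal part of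
the position, is rotation invariant. -/
lemma IsAxisymmetric.urOverR_rot {v : E3 → E3} (hv : IsAxisymmetric v) (α : ℝ) :
    ∀ᵐ y ∂(volume : Measure E3), urOverR v (rot α y) = urOverR v y := by
  filter_upwards [hv.apply_rot α] with y hy
  have h := Real.sin_sq_add_cos_sq α
  rw [urOverR_eq, urOverR_eq, hy, rad_rot]
  congr 1
  simp only [rot_zero_coord, rot_one_coord]
  linear_combination (y 0 * v y 0 + y 1 * v y 1) * h

lemma IsAxisymmetric.omegaOverR_rot {v : E3 → E3} (hv : IsAxisymmetric v) (α : ℝ) :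
    ∀ᵐ y ∂(volume : Measure E3), omegaOverR v (rot α y) = omegaOverR v y := by
  filter_upwards [hv.apply_rot α] with y hy
  have h := Real.sin_sq_add_cos_sq α
  rw [omegaOverR_eq, omegaOverR_eq, hy, rad_rot]
  congr 1
  simp only [rot_zero_coord, rot_one_coord]
  linear_combination (y 0 * v y 1 - y 1 * v y 0) * h

lemma IsAxisymmetric.vertical_rot {v : E3 → E3} (hv : IsAxisymmetric v) (α : ℝ) :
    ∀ᵐ y ∂(volume : Measure E3), v (rot α y) 2 = v y 2 := by
  filter_upwards [hv.apply_rot α] with y hy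
  rw [hy, rot_two_coord]

/-! ### Test fields that are radial about a point -/

/-- The vertical component of `y × x`, that is `|x_h| |y_h| sin (θ_x - θ_y)` in polar coordinates.
It is the angular derivative of `x_h · y_h` in `y`. -/
def cross (x y : E3) : ℝ := x 1 * y 0 - x 0 * y 1

/-- The scalar product `x_h · y_h` of the horizontal parts. -/
def hdot (x y : E3) : ℝ := x 0 * y 0 + x 1 * y 1

@[fun_prop] lemma continuous_cross (x : E3) : Continuous (cross x) := by unfold cross; fun_prop
@[fun_prop] lemma continuous_hdot (x : E3) : Continuous (hdot x) := by unfold hdot; fun_prop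

lemma cross_sq_add_hdot_sq (x y : E3) :
    cross x y ^ 2 + hdot x y ^ 2 = rad x ^ 2 * rad y ^ 2 := by
  rw [rad_sq, rad_sq, cross, hdot]; ring

lemma abs_cross_le (x y : E3) : |cross x y| ≤ rad x * rad y := by
  refine abs_le_of_sq_le_sq ?_ (mul_nonneg (rad_nonneg x) (rad_nonneg y))
  rw [mul_pow, ← cross_sq_add_hdot_sq]; nlinarith [sq_nonneg (hdot x y)]

lemma abs_hdot_le (x y : E3) : |hdot x y| ≤ rad x * rad y := by
  refine abs_le_of_sq_le_sq ?_ (mul_nonneg (rad_nonneg x) (rad_nonneg y))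
  rw [mul_pow, ← cross_sq_add_hdot_sq]; nlinarith [sq_nonneg (cross x y)]

lemma hasDerivAt_rot_zero (y : E3) (α : ℝ) :
    HasDerivAt (fun β => rot β y 0) (-(rot α y 1)) α := by
  have h : HasDerivAt (fun β => Real.cos β * y 0 - Real.sin β * y 1) _ α :=
    ((Real.hasDerivAt_cos α).mul_const (y 0)).sub ((Real.hasDerivAt_sin α).mul_const (y 1))
  refine h.congr_deriv ?_
  simp; ring

lemma hasDerivAt_rot_one (y : E3) (α : ℝ) :
    HasDerivAt (fun β => rot β y 1) (rot α y 0) α := by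
  have h : HasDerivAt (fun β => Real.sin β * y 0 + Real.cos β * y 1) _ α :=
    ((Real.hasDerivAt_sin α).mul_const (y 0)).add ((Real.hasDerivAt_cos α).mul_const (y 1))
  refine h.congr_deriv ?_
  simp; ring

lemma hasDerivAt_cross_rot (x y : E3) (α : ℝ) :
    HasDerivAt (fun β => cross x (rot β y)) (-hdot x (rot α y)) α := by
  have h : HasDerivAt (fun β => x 1 * rot β y 0 - x 0 * rot β y 1) _ α :=
    ((hasDerivAt_rot_zero y α).const_mul (x 1)).sub ((hasDerivAt_rot_one y α).const_mul (x 0))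
  refine h.congr_deriv ?_
  rw [hdot]; ring

lemma hasDerivAt_norm_sq_rot (x y : E3) (α : ℝ) :
    HasDerivAt (fun β => ‖rot β y - x‖ ^ 2) (-2 * cross x (rot α y)) α := by
  have h : HasDerivAt
      (fun β => (rot β y 0 - x 0) ^ 2 + (rot β y 1 - x 1) ^ 2 + (y 2 - x 2) ^ 2) _ α :=
    ((((hasDerivAt_rot_zero y α).sub_const (x 0)).fun_pow 2).add
      (((hasDerivAt_rot_one y α).sub_const (x 1)).fun_pow 2)).add_const _
  refine (h.congr_deriv ?_).congr_of_eventuallyEq (Filter.Eventually.of_forall fun β => ?_)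
  · rw [cross]; push_cast; ring
  · simp [norm_sq_eq]

lemma integrable_mul_of_support {f G : E3 → ℝ} (hf : LocallyIntegrable f volume)
    (hG : Continuous G) {T : ℝ} {x : E3} (hT : ∀ y, T < ‖y - x‖ ^ 2 → G y = 0) :
    Integrable (fun y => f y * G y) volume := by
  have hc : HasCompactSupport G := by
    refine HasCompactSupport.intro (isCompact_closedBall x (Real.sqrt T)) fun y hy => hT y ?_
    rw [mem_closedBall_iff_norm, not_le] at hy
    exact (Real.lt_sq_of_sqrt_lt hy)
  simpa [mul_comm] using hf.integrable_smul_left_of_hasCompactSupport hG hc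

lemma deriv_eq_zero_of_eq_zero {q : ℝ → ℝ} {T : ℝ} (hT : ∀ t, T < t → q t = 0) (t : ℝ)
    (ht : T < t) : deriv q t = 0 := by
  have : q =ᶠ[nhds t] fun _ => 0 := by
    filter_upwards [Ioi_mem_nhds ht] with z hz using hT z hz
  rw [this.deriv_eq, deriv_const]

/-- `(v · y_h / r²) · L` is controlled by `|v|` as soon as `L` is `O(r)`. -/
lemma integrable_urOverR_mul {v : E3 → E3} (hv : LocallyIntegrable v volume) {L K : E3 → ℝ}
    {A : ℝ} (hL : Continuous L) (hLA : ∀ y, |L y| ≤ A * rad y) (hK : Continuous K) {T : ℝ} {x : E3}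
    (hT : ∀ y, T < ‖y - x‖ ^ 2 → K y = 0) :
    Integrable (fun y => urOverR v y * (L y * K y)) volume := by
  have key : ∀ i : Fin 3, i = 0 ∨ i = 1 →
      Integrable (fun y => (y i * L y / rad y ^ 2) * (v y i * K y)) volume := fun i hi => by
    refine (integrable_mul_of_support (locallyIntegrable_coord hv i) hK hT).bdd_mul (c := A) ?_ ?_
    · exact (Measurable.div (by fun_prop)
        (continuous_rad.measurable.pow_const 2)).aestronglyMeasurable
    · filter_upwards [ae_rad_pos] with y hy
      rw [Real.norm_eq_abs, abs_div, abs_mul, abs_of_pos (pow_pos hy 2), div_le_iff₀ (pow_pos hy 2)]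
      have h1 : |y i| ≤ rad y := by
        refine abs_le_of_sq_le_sq ?_ hy.le
        rw [rad_sq]
        rcases hi with rfl | rfl
        · nlinarith [sq_nonneg (y 1)]
        · nlinarith [sq_nonneg (y 0)]
      calc |y i| * |L y| ≤ rad y * (A * rad y) :=
            mul_le_mul h1 (hLA y) (abs_nonneg _) hy.le
        _ = A * rad y ^ 2 := by ring
  refine ((key 0 (Or.inl rfl)).add (key 1 (Or.inr rfl))).congr
    (Filter.Eventually.of_forall fun y => ?_)
  simp only [Pi.add_apply, urOverR_eq]
  ring

lemma pd_affine (a b c e : ℝ) (i : Fin 3) (y : E3) :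
    pd i (fun z => a * z 0 + b * z 1 + c * z 2 + e) y = ![a, b, c] i := by
  have h : ∀ j : Fin 3, HasFDerivAt (fun z : E3 => z j)
      (EuclideanSpace.proj (𝕜 := ℝ) j : E3 →L[ℝ] ℝ) y := fun j =>
    (EuclideanSpace.proj (𝕜 := ℝ) j : E3 →L[ℝ] ℝ).hasFDerivAt
  have h2 : HasFDerivAt (fun z : E3 => a * z 0 + b * z 1 + c * z 2 + e) _ y :=
    ((((h 0).const_mul a).add ((h 1).const_mul b)).add ((h 2).const_mul c)).add_const e
  rw [pd_eq_of_hasFDerivAt h2]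
  fin_cases i <;> simp

lemma pd_radial_mul {q : ℝ → ℝ} (hq : Differentiable ℝ q) (x : E3) {l : E3 → ℝ} {y : E3}
    (hl : DifferentiableAt ℝ l y) (i : Fin 3) :
    pd i (fun z => q (‖z - x‖ ^ 2) * l z) y =
      2 * deriv q (‖y - x‖ ^ 2) * (y i - x i) * l y + q (‖y - x‖ ^ 2) * pd i l y := by
  have h1 : HasFDerivAt (fun z : E3 => ‖z - x‖ ^ 2) _ y :=
    ((hasFDerivAt_id y).sub_const x).norm_sq
  have h2 : HasFDerivAt (fun z : E3 => q (‖z - x‖ ^ 2)) _ y :=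
    (hq (‖y - x‖ ^ 2)).hasDerivAt.comp_hasFDerivAt y h1
  have h3 : HasFDerivAt (fun z => q (‖z - x‖ ^ 2) * l z) _ y := h2.mul hl.hasFDerivAt
  rw [pd_eq_of_hasFDerivAt h3]
  simp [pd, EuclideanSpace.inner_single_right]
  ring

lemma fderiv_apply_eq (f : E3 → ℝ) (y v : E3) :
    fderiv ℝ f y v = v 0 * pd 0 f y + v 1 * pd 1 f y + v 2 * pd 2 f y := by
  have hv : v = v 0 • EuclideanSpace.single 0 1 + v 1 • EuclideanSpace.single 1 1 +
      v 2 • EuclideanSpace.single 2 1 := by apply ext3 <;> simp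
  conv_lhs => rw [hv]
  simp [pd]

/-- Testing the curl against `q(|y - x|²) (y - x) × x_h`, and the divergence against
`q(|y - x|²) (y - x) · x_h`, isolates the horizontal component of `u` along `x_h`. -/
lemma integral_hdot_eq_of_weakCurl {u ω : E3 → E3} (hu : LocallyIntegrable u volume)
    (hdiv : WeakDivFree u) (hcurl : IsWeakCurl u ω) {q : ℝ → ℝ}
    (hq : ContDiff ℝ (⊤ : ℕ∞) q) {T : ℝ} (hT : ∀ t, T < t → q t = 0) (x : E3) :
    -∫ y, hdot x (u y) * (3 * q (‖y - x‖ ^ 2) + 2 * ‖y - x‖ ^ 2 * deriv q (‖y - x‖ ^ 2)) =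
      ∫ y, q (‖y - x‖ ^ 2) *
        ((y 2 - x 2) * (x 0 * ω y 1 - x 1 * ω y 0) + cross x y * ω y 2) := by
  have hqd : Differentiable ℝ q := hq.differentiable (by simp)
  have hq'c : Continuous (deriv q) := hq.continuous_deriv (by simp)
  have hT' := deriv_eq_zero_of_eq_zero hT
  set l0 : E3 → ℝ := fun z => 0 * z 0 + 0 * z 1 + (-x 1) * z 2 + x 1 * x 2 with hl0
  set l1 : E3 → ℝ := fun z => 0 * z 0 + 0 * z 1 + x 0 * z 2 + (-(x 0 * x 2)) with hl1
  set l2 : E3 → ℝ := fun z => x 1 * z 0 + (-x 0) * z 1 + 0 * z 2 + 0 with hl2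
  set l : E3 → ℝ := fun z => x 0 * z 0 + x 1 * z 1 + 0 * z 2 + (-(x 0 ^ 2 + x 1 ^ 2)) with hl
  set Q : E3 → ℝ := fun z => q (‖z - x‖ ^ 2) with hQ
  have hQs : ContDiff ℝ (⊤ : ℕ∞) Q := hq.comp ((contDiff_id.sub contDiff_const).norm_sq ℝ)
  have hsupp : ∀ {F : Type} [NormedAddCommGroup F] [NormedSpace ℝ F] (k : E3 → F),
      HasCompactSupport fun z => Q z • k z := fun k => by
    refine HasCompactSupport.intro (isCompact_closedBall x (Real.sqrt T)) fun y hy => ?_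
    rw [mem_closedBall_iff_norm, not_le] at hy
    simp [hQ, hT _ (Real.lt_sq_of_sqrt_lt hy)]
  set ψ : E3 → E3 := fun z => Q z • (!₂[l0 z, l1 z, l2 z] : E3) with hψ
  set φ : E3 → ℝ := fun z => Q z * l z with hφ
  have hψs : ContDiff ℝ (⊤ : ℕ∞) ψ := by
    refine hQs.smul ?_
    rw [contDiff_euclidean]
    intro i
    fin_cases i <;> simp [hl0, hl1, hl2] <;> fun_prop
  have hφs : ContDiff ℝ (⊤ : ℕ∞) φ := hQs.mul (by rw [hl]; fun_prop)
  have hφc : HasCompactSupport φ := hsupp l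
  have hψ0 : (fun z => ψ z 0) = fun z => q (‖z - x‖ ^ 2) * l0 z := by funext z; simp [hψ, hQ]
  have hψ1 : (fun z => ψ z 1) = fun z => q (‖z - x‖ ^ 2) * l1 z := by funext z; simp [hψ, hQ]
  have hψ2 : (fun z => ψ z 2) = fun z => q (‖z - x‖ ^ 2) * l2 z := by funext z; simp [hψ, hQ]
  have hd0 : Differentiable ℝ l0 := by rw [hl0]; fun_prop
  have hd1 : Differentiable ℝ l1 := by rw [hl1]; fun_prop
  have hd2 : Differentiable ℝ l2 := by rw [hl2]; fun_prop
  have hd : Differentiable ℝ l := by rw [hl]; fun_prop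
  have hpt : ∀ y v : E3, inner ℝ v (curl ψ y) = fderiv ℝ φ y v -
      hdot x v * (3 * q (‖y - x‖ ^ 2) + 2 * ‖y - x‖ ^ 2 * deriv q (‖y - x‖ ^ 2)) := by
    intro y v
    have hn : ‖y - x‖ ^ 2 = (y 0 - x 0) ^ 2 + (y 1 - x 1) ^ 2 + (y 2 - x 2) ^ 2 := by
      rw [norm_sq_eq]; simp
    have hφ' : φ = fun z => q (‖z - x‖ ^ 2) * l z := rfl
    have ha0 := fun i => pd_affine 0 0 (-x 1) (x 1 * x 2) i y
    have ha1 := fun i => pd_affine 0 0 (x 0) (-(x 0 * x 2)) i y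
    have ha2 := fun i => pd_affine (x 1) (-x 0) 0 0 i y
    have ha := fun i => pd_affine (x 0) (x 1) 0 (-(x 0 ^ 2 + x 1 ^ 2)) i y
    rw [inner_eq, fderiv_apply_eq]
    simp only [curl, hψ0, hψ1, hψ2, hφ', pd_radial_mul hqd x (hd0 y), pd_radial_mul hqd x (hd1 y),
      pd_radial_mul hqd x (hd2 y), pd_radial_mul hqd x (hd y)]
    rw [← hl0] at ha0
    rw [← hl1] at ha1
    rw [← hl2] at ha2
    rw [← hl] at ha
    simp only [ha0, ha1, ha2, ha, hdot]
    generalize q (‖y - x‖ ^ 2) = q0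
    generalize deriv q (‖y - x‖ ^ 2) = q1
    rw [hn]
    simp [hl0, hl1, hl2, hl]
    ring
  have hint1 : Integrable (fun y => fderiv ℝ φ y (u y)) volume := by
    have hpd : ∀ i : Fin 3, Integrable (fun y => u y i * pd i φ y) volume := fun i => by
      have hc : Continuous (pd i φ) := (hφs.continuous_fderiv (by simp)).clm_apply continuous_const
      have hs : HasCompactSupport (pd i φ) := by
        have := hφc.fderiv ℝ
        exact this.comp_left (g := fun A : E3 →L[ℝ] ℝ => A (EuclideanSpace.single i 1)) rfl
      simpa [mul_comm] using
        (locallyIntegrable_coord hu i).integrable_smul_left_of_hasCompactSupport hc hs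
    simp only [fderiv_apply_eq]
    exact ((hpd 0).add (hpd 1)).add (hpd 2)
  have hint2 : Integrable (fun y => hdot x (u y) *
      (3 * q (‖y - x‖ ^ 2) + 2 * ‖y - x‖ ^ 2 * deriv q (‖y - x‖ ^ 2))) volume := by
    have hloc : LocallyIntegrable (fun y => hdot x (u y)) volume :=
      ((locallyIntegrable_coord hu 0).smul (x 0)).add ((locallyIntegrable_coord hu 1).smul (x 1))
    refine integrable_mul_of_support hloc (T := T) (x := x) ?_ fun y hy => ?_
    · have := hq.continuous
      fun_prop
    · rw [hT _ hy, hT' _ hy]; ring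
  have h1 := hcurl.2 ψ hψs (hsupp _)
  simp only [hpt] at h1
  rw [integral_sub hint1 hint2, hdiv φ hφs hφc, zero_sub] at h1
  rw [h1]
  refine integral_congr_ae (Filter.Eventually.of_forall fun y => ?_)
  simp only [inner_eq, cross]
  simp [hψ, hQ, hl0, hl1, hl2]
  ring

/-! ### The smooth representation identity -/

lemma contDiff_deriv_top {f : ℝ → ℝ} (hf : ContDiff ℝ (⊤ : ℕ∞) f) :
    ContDiff ℝ (⊤ : ℕ∞) (deriv f) := by
  have h : ContDiff ℝ ((⊤ : ℕ∞) + 1) f := by simpa using hf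
  exact (contDiff_succ_iff_deriv.1 h).2.2

lemma aestronglyMeasurable_urOverR {u : E3 → E3} (hu : LocallyIntegrable u volume) :
    AEStronglyMeasurable (urOverR u) volume := by
  have hum := fun i => (locallyIntegrable_coord hu i).aestronglyMeasurable.aemeasurable
  refine AEMeasurable.aestronglyMeasurable ?_
  have : urOverR u = fun y => (y 0 * u y 0 + y 1 * u y 1) / rad y ^ 2 := funext (urOverR_eq u)
  rw [this]
  have h0 := hum 0
  have h1 := hum 1
  have hr := continuous_rad.measurable.aemeasurable (μ := (volume : Measure E3))
  have c0 : AEMeasurable (fun y : E3 => y 0) volume := by fun_prop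
  have c1 : AEMeasurable (fun y : E3 => y 1) volume := by fun_prop
  exact ((c0.mul h0).add (c1.mul h1)).div (hr.pow_const 2)

/-- Integration by parts in the angle, on the velocity side. -/
lemma integral_hdot_mul_radial {u : E3 → E3} (hu : LocallyIntegrable u volume)
    (haxi : IsAxisymmetric u) (hns : NoSwirl u) {P : ℝ → ℝ} (hP : ContDiff ℝ 1 P) {T : ℝ}
    (hT : ∀ t, T < t → P t = 0) (x : E3) :
    ∫ y, hdot x (u y) * P (‖y - x‖ ^ 2) =
      -2 * ∫ y, urOverR u y * (cross x y * (cross x y * deriv P (‖y - x‖ ^ 2))) := by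
  have hPc := hP.continuous
  have hP'c : Continuous (deriv P) := hP.continuous_deriv le_rfl
  have hT' := deriv_eq_zero_of_eq_zero hT
  have hi1 : Integrable (fun y => urOverR u y * (hdot x y * P (‖y - x‖ ^ 2))) volume :=
    integrable_urOverR_mul hu (continuous_hdot x) (abs_hdot_le x) (by fun_prop) (T := T) (x := x)
      fun y hy => hT _ hy
  have hi2 : Integrable
      (fun y => urOverR u y * (cross x y * (cross x y * deriv P (‖y - x‖ ^ 2)))) volume :=
    integrable_urOverR_mul hu (continuous_cross x) (abs_cross_le x) (by fun_prop) (T := T) (x := x)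
      fun y hy => by rw [hT' _ hy, mul_zero]
  have hz := integral_mul_eq_zero_of_rot_invariant (F := urOverR u)
    (G := fun y => hdot x y * P (‖y - x‖ ^ 2) +
      2 * (cross x y * (cross x y * deriv P (‖y - x‖ ^ 2))))
    (H := fun y => -(cross x y * P (‖y - x‖ ^ 2))) haxi.urOverR_rot
    (aestronglyMeasurable_urOverR hu) (by fun_prop)
    ((hi1.add (hi2.const_mul 2)).congr (Filter.Eventually.of_forall fun y => by
      simp only [Pi.add_apply]; ring)) fun y α => by
      have h1 : HasDerivAt (fun β => P (‖rot β y - x‖ ^ 2)) _ α :=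
        (hP.differentiable one_ne_zero _).hasDerivAt.comp α (hasDerivAt_norm_sq_rot x y α)
      have h2 : HasDerivAt (fun β => -(cross x (rot β y) * P (‖rot β y - x‖ ^ 2))) _ α :=
        ((hasDerivAt_cross_rot x y α).mul h1).neg
      exact h2.congr_deriv (by ring)
  have hsplit : ∫ y, urOverR u y * (hdot x y * P (‖y - x‖ ^ 2) +
      2 * (cross x y * (cross x y * deriv P (‖y - x‖ ^ 2)))) =
      (∫ y, urOverR u y * (hdot x y * P (‖y - x‖ ^ 2))) +
        2 * ∫ y, urOverR u y * (cross x y * (cross x y * deriv P (‖y - x‖ ^ 2))) := by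
    rw [← integral_const_mul, ← integral_add hi1 (hi2.const_mul 2)]
    refine integral_congr_ae (Filter.Eventually.of_forall fun y => ?_)
    ring
  have hleft : ∫ y, hdot x (u y) * P (‖y - x‖ ^ 2) =
      ∫ y, urOverR u y * (hdot x y * P (‖y - x‖ ^ 2)) := by
    refine integral_congr_ae ?_
    filter_upwards [ae_rad_pos, hns] with y hy hsw
    rw [inner_eTheta, div_eq_zero_iff, or_iff_left hy.ne'] at hsw
    rw [urOverR_eq, ← mul_assoc]
    congr 1
    rw [div_mul_eq_mul_div, eq_div_iff (pow_pos hy 2).ne', rad_sq, hdot, hdot]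
    linear_combination (y 0 * x 1 - y 1 * x 0) * hsw
  rw [hleft]
  linarith

/-- Representation of `u` by `ω_θ / r` for the smooth compactly supported radial potential
`Φ(|y - x|²)`: the test identity with `q = 2 Φ'`, followed by an integration by parts in the angle.
The components of `ω` other than `ω_θ` drop out because they appear against angular derivatives. -/
lemma integral_hdot_eq_integral_omegaOverR {u ω : E3 → E3} (hu : LocallyIntegrable u volume)
    (haxi : IsAxisymmetric u) (hdiv : WeakDivFree u) (hcurl : IsWeakCurl u ω)
    (hf : LocallyIntegrable (omegaOverR ω) volume) {Φ : ℝ → ℝ} (hΦ : ContDiff ℝ (⊤ : ℕ∞) Φ)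
    {T : ℝ} (hT : ∀ t, T < t → Φ t = 0) (x : E3) :
    -∫ y, hdot x (u y) * (6 * deriv Φ (‖y - x‖ ^ 2) +
        4 * ‖y - x‖ ^ 2 * deriv (deriv Φ) (‖y - x‖ ^ 2)) =
      4 * ∫ y, omegaOverR ω y * ((x 2 - y 2) * cross x y ^ 2 * deriv (deriv Φ) (‖y - x‖ ^ 2)) := by
  have hω := hcurl.1
  have hωaxi := hcurl.isAxisymmetric haxi
  have hΦ1 := contDiff_deriv_top hΦ
  have hΦc := hΦ.continuous
  have hΦ1c := hΦ1.continuous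
  have hΦ2c : Continuous (deriv (deriv Φ)) := hΦ1.continuous_deriv (by simp)
  have hT1 := deriv_eq_zero_of_eq_zero hT
  have hT2 := deriv_eq_zero_of_eq_zero hT1
  have hD0 : ∀ y α, HasDerivAt (fun β => Φ (‖rot β y - x‖ ^ 2)) _ α := fun y α =>
    (hΦ.differentiable (by simp) _).hasDerivAt.comp α (hasDerivAt_norm_sq_rot x y α)
  have hD1 : ∀ y α, HasDerivAt (fun β => deriv Φ (‖rot β y - x‖ ^ 2)) _ α := fun y α =>
    (hΦ1.differentiable (by simp) _).hasDerivAt.comp α (hasDerivAt_norm_sq_rot x y α)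
  have hid := integral_hdot_eq_of_weakCurl hu hdiv hcurl (q := fun t => 2 * deriv Φ t)
    (contDiff_const.mul hΦ1) (T := T) (fun t ht => by rw [hT1 t ht, mul_zero]) x
  have hdq : ∀ t, deriv (fun t => 2 * deriv Φ t) t = 2 * deriv (deriv Φ) t := fun t =>
    deriv_const_mul _ (hΦ1.differentiable (by simp) t)
  have hωm := fun i => (locallyIntegrable_coord hω i).aestronglyMeasurable
  -- `G1`, `G2`, `G3` are angular derivatives; `G4` is what remains after the integration by parts.
  set G1 : E3 → ℝ := fun y => 2 * (y 2 - x 2) * (hdot x y * deriv Φ (‖y - x‖ ^ 2) +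
    2 * cross x y ^ 2 * deriv (deriv Φ) (‖y - x‖ ^ 2)) with hG1
  set G2 : E3 → ℝ := fun y => cross x y * (-2 * (y 2 - x 2) * deriv Φ (‖y - x‖ ^ 2)) with hG2
  set G3 : E3 → ℝ := fun y => 2 * cross x y * deriv Φ (‖y - x‖ ^ 2) with hG3
  set G4 : E3 → ℝ :=
    fun y => (x 2 - y 2) * cross x y ^ 2 * deriv (deriv Φ) (‖y - x‖ ^ 2) with hG4
  have hi1 : Integrable (fun y => omegaOverR ω y * G1 y) volume :=
    integrable_mul_of_support hf (by fun_prop) (T := T) (x := x) fun y hy => by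
      simp only [hG1, hT1 _ hy, hT2 _ hy]; ring
  have hi2 : Integrable (fun y => urOverR ω y * G2 y) volume :=
    integrable_urOverR_mul hω (continuous_cross x) (abs_cross_le x) (by fun_prop) (T := T)
      (x := x) fun y hy => by simp only [hT1 _ hy]; ring
  have hi3 : Integrable (fun y => ω y 2 * G3 y) volume :=
    integrable_mul_of_support (locallyIntegrable_coord hω 2) (by fun_prop) (T := T) (x := x)
      fun y hy => by simp only [hG3, hT1 _ hy]; ring
  have hi4 : Integrable (fun y => omegaOverR ω y * G4 y) volume :=
    integrable_mul_of_support hf (by fun_prop) (T := T) (x := x) fun y hy => by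
      simp only [hG4, hT2 _ hy]; ring
  have hz1 : ∫ y, omegaOverR ω y * G1 y = 0 :=
    integral_mul_eq_zero_of_rot_invariant
      (H := fun y => -2 * (y 2 - x 2) * (cross x y * deriv Φ (‖y - x‖ ^ 2)))
      hωaxi.omegaOverR_rot hf.aestronglyMeasurable (by fun_prop) hi1 fun y α => by
        have h : HasDerivAt (fun β => -2 * (y 2 - x 2) *
            (cross x (rot β y) * deriv Φ (‖rot β y - x‖ ^ 2))) _ α :=
          ((hasDerivAt_cross_rot x y α).mul (hD1 y α)).const_mul _
        exact h.congr_deriv (by simp only [hG1, rot_two_coord]; ring)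
  have hz2 : ∫ y, urOverR ω y * G2 y = 0 := by
    refine integral_mul_eq_zero_of_rot_invariant
      (H := fun y => (y 2 - x 2) * Φ (‖y - x‖ ^ 2))
      hωaxi.urOverR_rot (aestronglyMeasurable_urOverR hω) (by fun_prop) hi2 fun y α => ?_
    have h : HasDerivAt (fun β => (y 2 - x 2) * Φ (‖rot β y - x‖ ^ 2)) _ α :=
      (hD0 y α).const_mul _
    exact h.congr_deriv (by simp only [hG2, rot_two_coord]; ring)
  have hz3 : ∫ y, ω y 2 * G3 y = 0 := by
    refine integral_mul_eq_zero_of_rot_invariant (H := fun y => -Φ (‖y - x‖ ^ 2))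
      hωaxi.vertical_rot (hωm 2) (by fun_prop) hi3 fun y α => ?_
    have h : HasDerivAt (fun β => -Φ (‖rot β y - x‖ ^ 2)) _ α := (hD0 y α).neg
    exact h.congr_deriv (by simp only [hG3]; ring)
  have hleft : ∀ y, hdot x (u y) * (6 * deriv Φ (‖y - x‖ ^ 2) +
        4 * ‖y - x‖ ^ 2 * deriv (deriv Φ) (‖y - x‖ ^ 2)) =
      hdot x (u y) * (3 * (2 * deriv Φ (‖y - x‖ ^ 2)) +
        2 * ‖y - x‖ ^ 2 * deriv (fun t => 2 * deriv Φ t) (‖y - x‖ ^ 2)) := fun y => by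
    rw [hdq]; ring
  simp only [hleft]
  rw [hid]
  have hi12 : Integrable (fun y => omegaOverR ω y * G1 y + urOverR ω y * G2 y) volume :=
    hi1.add hi2
  have hi123 : Integrable
      (fun y => omegaOverR ω y * G1 y + urOverR ω y * G2 y + ω y 2 * G3 y) volume := hi12.add hi3
  calc _ = ∫ y, (omegaOverR ω y * G1 y + urOverR ω y * G2 y + ω y 2 * G3 y +
        4 * (omegaOverR ω y * G4 y)) := by
        refine integral_congr_ae ?_
        filter_upwards [ae_rad_pos] with y hy
        have hdec : x 0 * ω y 1 - x 1 * ω y 0 =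
            hdot x y * omegaOverR ω y - cross x y * urOverR ω y := by
          rw [omegaOverR_eq, urOverR_eq, mul_div_assoc', mul_div_assoc', ← sub_div,
            eq_div_iff (pow_pos hy 2).ne', rad_sq, hdot, cross]
          ring
        simp only [hdec, hG1, hG2, hG3, hG4]
        ring
    _ = 4 * ∫ y, omegaOverR ω y * G4 y := by
        rw [integral_add hi123 (hi4.const_mul 4), integral_add hi12 hi3, integral_add hi1 hi2,
          hz1, hz2, hz3, integral_const_mul]
        ring

/-! ### A smooth substitute for the Newtonian potential -/

/-- A smooth profile `b` that agrees with `1 / (4π √t)` for `t ≥ 1`, so that `b (|y|²)` is a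
regularization of the Newtonian potential that is exact outside the unit ball. It vanishes for
`t ≤ 1 / 2`, so the singular point `0` of the root is harmless. -/
noncomputable def profile (t : ℝ) : ℝ :=
  Real.smoothTransition (2 * t - 1) * (4 * Real.pi * Real.sqrt t)⁻¹

lemma profile_of_one_le {t : ℝ} (ht : 1 ≤ t) : profile t = (4 * Real.pi * Real.sqrt t)⁻¹ := by
  rw [profile, Real.smoothTransition.one_of_one_le (by linarith), one_mul]

lemma profile_of_le_half {t : ℝ} (ht : t ≤ 1 / 2) : profile t = 0 := by
  rw [profile, Real.smoothTransition.zero_of_nonpos (by linarith), zero_mul]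

lemma contDiff_profile : ContDiff ℝ (⊤ : ℕ∞) profile := by
  rw [contDiff_iff_contDiffAt]
  intro t
  rcases lt_or_ge t (1 / 2) with ht | ht
  · have : profile =ᶠ[nhds t] fun _ => 0 := by
      filter_upwards [Iio_mem_nhds ht] with s hs using profile_of_le_half (le_of_lt hs)
    exact contDiffAt_const.congr_of_eventuallyEq this
  · have ht0 : 0 < t := by linarith
    unfold profile
    refine ContDiffAt.mul ?_
      (ContDiffAt.inv (contDiffAt_const.mul (Real.contDiffAt_sqrt ht0.ne')) ?_)
    · exact (Real.smoothTransition.contDiff.comp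
        ((contDiff_const.mul contDiff_id).sub contDiff_const)).contDiffAt
    · have := Real.sqrt_pos.2 ht0
      have := Real.pi_pos
      positivity

lemma deriv_profile {t : ℝ} (ht : 1 < t) :
    deriv profile t = -(8 * Real.pi * t * Real.sqrt t)⁻¹ := by
  have h : profile =ᶠ[nhds t] fun s => (4 * Real.pi * Real.sqrt s)⁻¹ := by
    filter_upwards [Ioi_mem_nhds ht] with s hs using profile_of_one_le (le_of_lt hs)
  have ht0 : 0 < t := by linarith
  have hs := Real.sqrt_pos.2 ht0
  have hpi := Real.pi_pos
  rw [h.deriv_eq]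
  have h1 : HasDerivAt (fun s => (4 * Real.pi * Real.sqrt s)⁻¹) _ t :=
    ((Real.hasDerivAt_sqrt ht0.ne').const_mul (4 * Real.pi)).inv (by positivity)
  rw [h1.deriv, mul_pow, Real.sq_sqrt ht0.le]
  field_simp
  ring

lemma deriv_deriv_profile {t : ℝ} (ht : 1 < t) :
    deriv (deriv profile) t = 3 * (16 * Real.pi * t ^ 2 * Real.sqrt t)⁻¹ := by
  have h : deriv profile =ᶠ[nhds t] fun s => -(8 * Real.pi * s * Real.sqrt s)⁻¹ := by
    filter_upwards [Ioi_mem_nhds ht] with s hs using deriv_profile hs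
  have ht0 : 0 < t := by linarith
  have hs := Real.sqrt_pos.2 ht0
  have hpi := Real.pi_pos
  rw [h.deriv_eq]
  have h1 : HasDerivAt (fun s => -(8 * Real.pi * s * Real.sqrt s)⁻¹) _ t :=
    ((((hasDerivAt_id t).const_mul (8 * Real.pi)).mul
      (Real.hasDerivAt_sqrt ht0.ne')).fun_inv
        (show 8 * Real.pi * t * Real.sqrt t ≠ 0 by positivity)).neg
  rw [h1.deriv]
  simp only [Pi.mul_apply, id, mul_pow, Real.sq_sqrt ht0.le]
  field_simp
  rw [Real.sq_sqrt ht0.le]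
  ring

/-- The function `p` with `p (|y|²) = -Δ (b (|y|²))`, for `b = profile`: a bump of integral one. -/
noncomputable def bump (t : ℝ) : ℝ := -(6 * deriv profile t + 4 * t * deriv (deriv profile) t)

lemma contDiff_bump : ContDiff ℝ (⊤ : ℕ∞) bump := by
  have h1 := contDiff_deriv_top contDiff_profile
  have h2 := contDiff_deriv_top h1
  unfold bump
  fun_prop

lemma bump_of_one_lt {t : ℝ} (ht : 1 < t) : bump t = 0 := by
  have hs := Real.sqrt_pos.2 (zero_lt_one.trans ht)
  have hpi := Real.pi_pos
  rw [bump, deriv_profile ht, deriv_deriv_profile ht]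
  field_simp
  ring

lemma bounded_of_eq_zero {g : ℝ → ℝ} (hg : Continuous g) {T : ℝ} (h : ∀ t, T < t → g t = 0) :
    ∃ M, 0 ≤ M ∧ ∀ t, 0 ≤ t → |g t| ≤ M := by
  obtain ⟨M, hM⟩ := (isCompact_Icc (a := (0 : ℝ)) (b := T)).exists_bound_of_continuousOn
    hg.continuousOn
  refine ⟨max M 0, le_max_right _ _, fun t ht => ?_⟩
  rcases le_or_gt t T with h1 | h1
  · exact (hM t ⟨ht, h1⟩).trans (le_max_left _ _)
  · rw [h t h1, abs_zero]; exact le_max_right _ _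

lemma deriv_deriv_profile_bound :
    ∃ M, 0 ≤ M ∧ ∀ t, 0 < t → |deriv (deriv profile) t| ≤ M / (t ^ 2 * Real.sqrt t) := by
  have hc : Continuous (deriv (deriv profile)) :=
    (contDiff_deriv_top (contDiff_deriv_top contDiff_profile)).continuous
  obtain ⟨M, hM⟩ := (isCompact_Icc (a := (0 : ℝ)) (b := 1)).exists_bound_of_continuousOn
    hc.continuousOn
  have hpi := Real.pi_pos
  have hpi3 := Real.pi_gt_three
  refine ⟨max M 1, le_max_of_le_right zero_le_one, fun t ht => ?_⟩
  have hs := Real.sqrt_pos.2 ht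
  rw [le_div_iff₀ (by positivity)]
  rcases le_or_gt t 1 with h1 | h1
  · have hs1 : Real.sqrt t ≤ 1 := Real.sqrt_le_one.2 h1
    have h2 : t ^ 2 * Real.sqrt t ≤ 1 :=
      mul_le_one₀ (pow_le_one₀ ht.le h1) hs.le hs1
    calc |deriv (deriv profile) t| * (t ^ 2 * Real.sqrt t)
        ≤ |deriv (deriv profile) t| * 1 := by gcongr
      _ ≤ max M 1 := by rw [mul_one]; exact (hM t ⟨ht.le, h1⟩).trans (le_max_left _ _)
  · rw [deriv_deriv_profile h1, abs_of_pos (by positivity)]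
    refine le_trans ?_ (le_max_right M 1)
    have : 3 * (16 * Real.pi * t ^ 2 * Real.sqrt t)⁻¹ * (t ^ 2 * Real.sqrt t) =
        3 / (16 * Real.pi) := by
      field_simp
    rw [this, div_le_one (by positivity)]
    linarith

/-- The bump has integral one: its radial mass is the flux of `-∇ (b (|y|²))` through a sphere. -/
lemma integral_bump : ∫ y : E3, bump (‖y‖ ^ 2) = 1 := by
  have hb1 := contDiff_deriv_top contDiff_profile
  have hb2 := contDiff_deriv_top hb1
  have hpi := Real.pi_pos
  rw [integral_fun_norm_addHaar (μ := (volume : Measure E3)) (f := fun r => bump (r ^ 2))]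
  have hvol : (volume : Measure E3).real (Metric.ball 0 1) = Real.pi * 4 / 3 := by
    rw [Measure.real, EuclideanSpace.volume_ball_fin_three]
    simp only [ENNReal.ofReal_one, one_pow, one_mul]
    exact ENNReal.toReal_ofReal (by positivity)
  have hdim : Module.finrank ℝ E3 = 3 := by simp
  have hrad : ∫ r in Set.Ioi (0 : ℝ), r ^ (3 - 1) • bump (r ^ 2) = 1 / (4 * Real.pi) := by
    -- The upper limit is `2` rather than `1` because the profile is explicit only beyond `1`.
    have h1 : ∫ r in Set.Ioi (0 : ℝ), r ^ (3 - 1) • bump (r ^ 2) =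
        ∫ r in (0 : ℝ)..2, r ^ 2 * bump (r ^ 2) := by
      rw [intervalIntegral.integral_of_le (by norm_num)]
      refine setIntegral_eq_of_subset_of_forall_sdiff_eq_zero measurableSet_Ioi
        Set.Ioc_subset_Ioi_self fun r hr => ?_
      have hr2 : 2 < r := by
        by_contra h
        exact hr.2 ⟨hr.1, not_lt.1 h⟩
      rw [bump_of_one_lt (by nlinarith), smul_zero]
    have hF : ∀ r : ℝ, HasDerivAt (fun r => -2 * r ^ 3 * deriv profile (r ^ 2))
        (r ^ 2 * bump (r ^ 2)) r := fun r => by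
      have h2 : HasDerivAt (fun r : ℝ => deriv profile (r ^ 2)) _ r :=
        HasDerivAt.comp (h₂ := deriv profile) (h := fun s : ℝ => s ^ 2) r
          (hb1.differentiable (by simp) (r ^ 2)).hasDerivAt (hasDerivAt_pow 2 r)
      have h3 : HasDerivAt (fun r : ℝ => -2 * r ^ 3 * deriv profile (r ^ 2)) _ r :=
        ((hasDerivAt_pow 3 r).const_mul (-2)).mul h2
      exact h3.congr_deriv (by rw [bump]; push_cast; ring)
    have hc := contDiff_bump.continuous
    rw [h1, intervalIntegral.integral_eq_sub_of_hasDerivAt (fun r _ => hF r)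
      (Continuous.intervalIntegrable (by fun_prop) _ _), deriv_profile (by norm_num)]
    have h4 : Real.sqrt (2 ^ 2) = 2 := Real.sqrt_sq (by norm_num)
    rw [h4]
    field_simp
    norm_num
  rw [hdim, hvol, hrad]
  simp only [smul_eq_mul, nsmul_eq_mul]
  field_simp
  norm_num

/-- The rescaled profile `c b(c² t)`, which regularizes the potential at scale `1 / c`. -/
noncomputable def profileScaled (c t : ℝ) : ℝ := c * profile (c ^ 2 * t)

lemma contDiff_profileScaled (c : ℝ) : ContDiff ℝ (⊤ : ℕ∞) (profileScaled c) :=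
  contDiff_const.mul (contDiff_profile.comp (contDiff_const.mul contDiff_id))

lemma profileScaled_of_le {c t : ℝ} (hc : 0 < c) (ht : 1 ≤ c ^ 2 * t) :
    profileScaled c t = (4 * Real.pi * Real.sqrt t)⁻¹ := by
  rw [profileScaled, profile_of_one_le ht, Real.sqrt_mul (by positivity), Real.sqrt_sq hc.le]
  have : Real.sqrt t ≠ 0 := by
    refine (Real.sqrt_pos.2 ?_).ne'
    by_contra h
    nlinarith [sq_nonneg c]
  field_simp

lemma deriv_profileScaled (c t : ℝ) :
    deriv (profileScaled c) t = c ^ 3 * deriv profile (c ^ 2 * t) := by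
  have h : HasDerivAt (profileScaled c) _ t :=
    (((contDiff_profile.differentiable (by simp) (c ^ 2 * t)).hasDerivAt.comp t
      ((hasDerivAt_id t).const_mul (c ^ 2)))).const_mul c
  rw [h.deriv]
  ring

lemma deriv_deriv_profileScaled (c t : ℝ) :
    deriv (deriv (profileScaled c)) t = c ^ 5 * deriv (deriv profile) (c ^ 2 * t) := by
  rw [show deriv (profileScaled c) = fun t => c ^ 3 * deriv profile (c ^ 2 * t) from
    funext (deriv_profileScaled c)]
  have h : HasDerivAt (fun t => c ^ 3 * deriv profile (c ^ 2 * t)) _ t :=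
    ((((contDiff_deriv_top contDiff_profile).differentiable (by simp) (c ^ 2 * t)).hasDerivAt.comp t
      ((hasDerivAt_id t).const_mul (c ^ 2)))).const_mul (c ^ 3)
  rw [h.deriv]
  ring

/-! ### The limit of vanishing regularization -/

lemma bump_scaled_eq_zero {c : ℝ} (hc : 0 < c) {t : ℝ} (ht : c⁻¹ ^ 2 < t) :
    bump (c ^ 2 * t) = 0 := by
  refine bump_of_one_lt ?_
  rw [inv_pow, inv_lt_iff_one_lt_mul₀ (by positivity)] at ht
  rwa [mul_comm]

lemma integral_bump_scaled {c : ℝ} (hc : 0 < c) (x : E3) :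
    ∫ y : E3, c ^ 3 * bump (c ^ 2 * ‖y - x‖ ^ 2) = 1 := by
  rw [integral_sub_right_eq_self (fun y : E3 => c ^ 3 * bump (c ^ 2 * ‖y‖ ^ 2)) x,
    integral_const_mul]
  have h := Measure.integral_comp_smul (volume : Measure E3) (fun y => bump (‖y‖ ^ 2)) c
  simp only [norm_smul, mul_pow, Real.norm_eq_abs, sq_abs, integral_bump, finrank_euclideanSpace,
    Fintype.card_fin, smul_eq_mul, mul_one] at h
  rw [h, abs_of_pos (by positivity)]
  field_simp

lemma volume_real_closedBall (x : E3) {r : ℝ} (hr : 0 ≤ r) :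
    (volume : Measure E3).real (Metric.closedBall x r) = r ^ 3 * (Real.pi * 4 / 3) := by
  rw [Measure.real, Measure.addHaar_closedBall_eq_addHaar_ball,
    EuclideanSpace.volume_ball_fin_three, ENNReal.toReal_mul, ENNReal.toReal_pow,
    ENNReal.toReal_ofReal hr, ENNReal.toReal_ofReal (by positivity)]

lemma hdot_sub (x a b : E3) : hdot x (a - b) = hdot x a - hdot x b := by
  simp [hdot]; ring

lemma locallyIntegrable_hdot {u : E3 → E3} (hu : LocallyIntegrable u volume) (x : E3) :
    LocallyIntegrable (fun y => hdot x (u y)) volume :=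
  ((locallyIntegrable_coord hu 0).smul (x 0)).add ((locallyIntegrable_coord hu 1).smul (x 1))

/-- At a Lebesgue point the mollified velocity converges. -/
lemma tendsto_integral_bump_near {u : E3 → E3} (hu : LocallyIntegrable u volume) {x : E3}
    {c : ℕ → ℝ} (hc : ∀ n, 0 < c n)
    (hL : Tendsto (fun n => ⨍ y in Metric.closedBall x (c n)⁻¹, ‖u y - u x‖) atTop (𝓝 0)) :
    Tendsto (fun n => ∫ y, hdot x (u y) * (c n ^ 3 * bump (c n ^ 2 * ‖y - x‖ ^ 2))) atTop
      (𝓝 (hdot x (u x))) := by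
  obtain ⟨M, hM0, hM⟩ := bounded_of_eq_zero contDiff_bump.continuous fun t ht => bump_of_one_lt ht
  have hbc := contDiff_bump.continuous
  have hpi := Real.pi_pos
  have hbound : ∀ n, |(∫ y, hdot x (u y) * (c n ^ 3 * bump (c n ^ 2 * ‖y - x‖ ^ 2))) -
      hdot x (u x)| ≤ (rad x * M * (Real.pi * 4 / 3)) *
        ⨍ y in Metric.closedBall x (c n)⁻¹, ‖u y - u x‖ := fun n => by
    have hcn := hc n
    set K : E3 → ℝ := fun y => c n ^ 3 * bump (c n ^ 2 * ‖y - x‖ ^ 2) with hK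
    have hKc : Continuous K := by fun_prop
    have hKT : ∀ y, (c n)⁻¹ ^ 2 < ‖y - x‖ ^ 2 → K y = 0 := fun y hy => by
      simp only [hK, bump_scaled_eq_zero hcn hy, mul_zero]
    have hi1 := integrable_mul_of_support (locallyIntegrable_hdot hu x) hKc hKT
    have hi2 := integrable_mul_of_support (locallyIntegrable_const (hdot x (u x))) hKc hKT
    have heq : (∫ y, hdot x (u y) * K y) - hdot x (u x) = ∫ y, hdot x (u y - u x) * K y := by
      have h1 : ∫ y, hdot x (u x) * K y = hdot x (u x) := by
        rw [integral_const_mul, integral_bump_scaled hcn, mul_one]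
      conv_lhs => rw [← h1]
      rw [← integral_sub hi1 hi2]
      refine integral_congr_ae (Eventually.of_forall fun y => ?_)
      simp only [hdot_sub]; ring
    have hset : ∫ y, hdot x (u y - u x) * K y =
        ∫ y in Metric.closedBall x (c n)⁻¹, hdot x (u y - u x) * K y := by
      refine (setIntegral_eq_integral_of_forall_compl_eq_zero fun y hy => ?_).symm
      rw [mem_closedBall_iff_norm, not_le] at hy
      rw [hKT y (by gcongr), mul_zero]
    have hiu : IntegrableOn (fun y => ‖u y - u x‖) (Metric.closedBall x (c n)⁻¹) volume :=
      ((hu.integrableOn_isCompact (isCompact_closedBall _ _)).sub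
        (integrableOn_const (isCompact_closedBall _ _).measure_lt_top.ne)).norm
    rw [heq, hset, setAverage_eq, volume_real_closedBall x (inv_pos.2 hcn).le]
    calc |∫ y in Metric.closedBall x (c n)⁻¹, hdot x (u y - u x) * K y|
        ≤ ∫ y in Metric.closedBall x (c n)⁻¹, (rad x * (c n ^ 3 * M)) * ‖u y - u x‖ := by
          rw [← Real.norm_eq_abs]
          refine norm_integral_le_of_norm_le (hiu.const_mul _) (Eventually.of_forall fun y => ?_)
          have h1 : |hdot x (u y - u x)| ≤ rad x * ‖u y - u x‖ :=
            (abs_hdot_le _ _).trans (mul_le_mul_of_nonneg_left (rad_le_norm _) (rad_nonneg _))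
          have h2 : |K y| ≤ c n ^ 3 * M := by
            rw [hK, abs_mul, abs_of_pos (pow_pos hcn 3)]
            exact mul_le_mul_of_nonneg_left (hM _ (by positivity)) (by positivity)
          rw [Real.norm_eq_abs, abs_mul]
          calc _ ≤ (rad x * ‖u y - u x‖) * (c n ^ 3 * M) :=
                mul_le_mul h1 h2 (abs_nonneg _) (mul_nonneg (rad_nonneg _) (norm_nonneg _))
            _ = _ := by ring
      _ = _ := by
          rw [integral_const_mul, smul_eq_mul]
          field_simp
  have h0 : Tendsto (fun n => (∫ y, hdot x (u y) * (c n ^ 3 * bump (c n ^ 2 * ‖y - x‖ ^ 2))) -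
      hdot x (u x)) atTop (𝓝 0) := by
    refine squeeze_zero_norm hbound ?_
    simpa using hL.const_mul (rad x * M * (Real.pi * 4 / 3))
  simpa using h0.add_const (hdot x (u x))

/-- The mass of an `L^p` field in a large ball grows at most like the volume. -/
lemma exists_setIntegral_closedBall_le {u : E3 → E3} {p : ℝ≥0∞} (hp : 1 ≤ p)
    (hu : MemLp u p volume) (x : E3) :
    ∃ A, 0 ≤ A ∧ ∀ r, 1 ≤ r → ∫ y in Metric.closedBall x r, ‖u y‖ ≤ A * r ^ 3 := by
  have hpi := Real.pi_pos
  refine ⟨(eLpNorm u p volume).toReal * (1 + Real.pi * 4 / 3), by positivity, fun r hr => ?_⟩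
  set B := Metric.closedBall x r
  have hr0 : 0 ≤ r := by linarith
  have hVtop : volume B ≠ ∞ := (isCompact_closedBall x r).measure_lt_top.ne
  have hexp : (0 : ℝ) ≤ 1 / (1 : ℝ≥0∞).toReal - 1 / p.toReal ∧
      1 / (1 : ℝ≥0∞).toReal - 1 / p.toReal ≤ 1 := by
    rw [ENNReal.toReal_one, div_one]
    refine ⟨?_, by linarith [show (0 : ℝ) ≤ 1 / p.toReal by positivity]⟩
    rcases eq_or_ne p ∞ with rfl | hpt
    · simp
    · have h1 : 1 ≤ p.toReal := by
        rw [← ENNReal.toReal_one]; exact ENNReal.toReal_mono hpt hp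
      linarith [(div_le_one (by linarith)).2 h1]
  have hle : eLpNorm u 1 (volume.restrict B) ≤ eLpNorm u p volume * (1 + volume B) := by
    refine (eLpNorm_le_eLpNorm_mul_rpow_measure_univ hp hu.1.restrict).trans ?_
    rw [Measure.restrict_apply_univ]
    gcongr
    · exact Measure.restrict_le_self
    · calc volume B ^ (1 / (1 : ℝ≥0∞).toReal - 1 / p.toReal)
          ≤ (1 + volume B) ^ (1 / (1 : ℝ≥0∞).toReal - 1 / p.toReal) :=
            ENNReal.rpow_le_rpow le_add_self hexp.1
        _ ≤ (1 + volume B) ^ (1 : ℝ) := ENNReal.rpow_le_rpow_of_exponent_le le_self_add hexp.2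
        _ = 1 + volume B := ENNReal.rpow_one _
  have hnorm : ∫ y in B, ‖u y‖ = (eLpNorm u 1 (volume.restrict B)).toReal := by
    rw [eLpNorm_one_eq_lintegral_enorm, integral_norm_eq_lintegral_enorm hu.1.restrict]
  rw [hnorm]
  refine (ENNReal.toReal_mono (ENNReal.mul_ne_top hu.2.ne (by simp [hVtop])) hle).trans ?_
  rw [ENNReal.toReal_mul, ENNReal.toReal_add ENNReal.one_ne_top hVtop, ENNReal.toReal_one,
    mul_assoc]
  refine mul_le_mul_of_nonneg_left ?_ ENNReal.toReal_nonneg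
  have hV : (volume B).toReal = r ^ 3 * (Real.pi * 4 / 3) := volume_real_closedBall x hr0
  rw [hV]
  nlinarith [one_le_pow₀ hr (n := 3)]

lemma abs_urOverR_mul_le (u : E3 → E3) (x y : E3) :
    |urOverR u y * (cross x y * cross x y)| ≤ ‖u y‖ * rad x ^ 2 * rad y := by
  rcases (rad_nonneg y).eq_or_lt with hy | hy
  · have : urOverR u y = 0 := by rw [urOverR_eq, ← hy]; simp
    rw [this, ← hy]; simp
  have h1 : |y 0 * u y 0 + y 1 * u y 1| ≤ rad y * ‖u y‖ :=
    (abs_hdot_le y (u y)).trans (mul_le_mul_of_nonneg_left (rad_le_norm _) hy.le)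
  have h2 : |cross x y * cross x y| ≤ (rad x * rad y) * (rad x * rad y) := by
    rw [abs_mul]
    exact mul_self_le_mul_self (abs_nonneg _) (abs_cross_le x y)
  rw [urOverR_eq, abs_mul, abs_div, abs_of_pos (pow_pos hy 2), div_mul_eq_mul_div,
    div_le_iff₀ (pow_pos hy 2)]
  calc _ ≤ (rad y * ‖u y‖) * ((rad x * rad y) * (rad x * rad y)) :=
        mul_le_mul h1 h2 (abs_nonneg _) (by positivity)
    _ = _ := by ring

/-- The large scale part of the mollified velocity disappears. For `p = ∞` the averages of `u` alone
need not vanish: the integration by parts in the angle gains the missing power of the radius. -/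
lemma tendsto_integral_bump_far {u : E3 → E3} {p : ℝ≥0∞} (hp : 1 ≤ p)
    (hu : MemLp u p volume) (haxi : IsAxisymmetric u) (hns : NoSwirl u) (x : E3)
    {c : ℕ → ℝ} (hc : ∀ n, 1 ≤ c n) (hctop : Tendsto c atTop atTop) :
    Tendsto (fun n => ∫ y, hdot x (u y) * ((c n)⁻¹ ^ 3 * bump ((c n)⁻¹ ^ 2 * ‖y - x‖ ^ 2))) atTop
      (𝓝 0) := by
  have hul := hu.locallyIntegrable hp
  have hb' : Continuous (deriv bump) := (contDiff_deriv_top contDiff_bump).continuous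
  have hb'0 := deriv_eq_zero_of_eq_zero (q := bump) (T := 1) fun t ht => bump_of_one_lt ht
  obtain ⟨M, hM0, hM⟩ := bounded_of_eq_zero hb' hb'0
  obtain ⟨A, hA0, hA⟩ := exists_setIntegral_closedBall_le hp hu x
  have hbound : ∀ n, |∫ y, hdot x (u y) * ((c n)⁻¹ ^ 3 * bump ((c n)⁻¹ ^ 2 * ‖y - x‖ ^ 2))| ≤
      2 * (rad x ^ 2 * (‖x‖ + 1) * M * A) * (c n)⁻¹ := fun n => by
    have hcn : 0 < c n := one_pos.trans_le (hc n)
    set C := (c n)⁻¹ with hC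
    have hCpos : 0 < C := inv_pos.2 hcn
    have hPs : ContDiff ℝ 1 fun t => C ^ 3 * bump (C ^ 2 * t) :=
      (contDiff_const.mul (contDiff_bump.comp (contDiff_const.mul contDiff_id))).of_le (by simp)
    have hPT : ∀ t, C⁻¹ ^ 2 < t → C ^ 3 * bump (C ^ 2 * t) = 0 := fun t ht => by
      rw [bump_scaled_eq_zero hCpos ht, mul_zero]
    have hd : ∀ t, deriv (fun t => C ^ 3 * bump (C ^ 2 * t)) t = C ^ 5 * deriv bump (C ^ 2 * t) :=
      fun t => by
        have h : HasDerivAt (fun t => C ^ 3 * bump (C ^ 2 * t)) _ t :=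
          (((contDiff_bump.differentiable (by simp) (C ^ 2 * t)).hasDerivAt.comp t
            ((hasDerivAt_id t).const_mul (C ^ 2)))).const_mul (C ^ 3)
        rw [h.deriv]; ring
    have hmain := integral_hdot_mul_radial hul haxi hns hPs hPT x
    rw [hmain]
    simp only [hd]
    have hset : ∫ y, urOverR u y * (cross x y * (cross x y * (C ^ 5 *
          deriv bump (C ^ 2 * ‖y - x‖ ^ 2)))) = ∫ y in Metric.closedBall x (c n),
        urOverR u y * (cross x y * (cross x y * (C ^ 5 * deriv bump (C ^ 2 * ‖y - x‖ ^ 2)))) := by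
      refine (setIntegral_eq_integral_of_forall_compl_eq_zero fun y hy => ?_).symm
      rw [mem_closedBall_iff_norm, not_le] at hy
      have h1 : 1 < C ^ 2 * ‖y - x‖ ^ 2 := by
        rw [← mul_pow, hC]
        refine one_lt_pow₀ ?_ two_ne_zero
        rw [inv_mul_eq_div, one_lt_div hcn]
        exact hy
      rw [hb'0 _ h1]; ring
    have hiu : IntegrableOn (fun y => ‖u y‖) (Metric.closedBall x (c n)) volume :=
      (hul.integrableOn_isCompact (isCompact_closedBall _ _)).norm
    have hest : |∫ y in Metric.closedBall x (c n), urOverR u y * (cross x y * (cross x y *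
        (C ^ 5 * deriv bump (C ^ 2 * ‖y - x‖ ^ 2))))| ≤
        ∫ y in Metric.closedBall x (c n),
          (rad x ^ 2 * ((‖x‖ + 1) * c n) * (C ^ 5 * M)) * ‖u y‖ := by
      rw [← Real.norm_eq_abs]
      refine norm_integral_le_of_norm_le (hiu.const_mul _)
        ((ae_restrict_iff' Metric.isClosed_closedBall.measurableSet).2
          (Eventually.of_forall fun y hy => ?_))
      rw [mem_closedBall_iff_norm] at hy
      have hry : rad y ≤ (‖x‖ + 1) * c n := by
        have h1 : ‖y‖ ≤ ‖x‖ + c n := by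
          calc ‖y‖ = ‖x + (y - x)‖ := by rw [add_sub_cancel]
            _ ≤ ‖x‖ + ‖y - x‖ := norm_add_le _ _
            _ ≤ _ := by linarith
        nlinarith [rad_le_norm y, norm_nonneg x, hc n]
      have h2 : |C ^ 5 * deriv bump (C ^ 2 * ‖y - x‖ ^ 2)| ≤ C ^ 5 * M := by
        rw [abs_mul, abs_of_pos (pow_pos hCpos 5)]
        exact mul_le_mul_of_nonneg_left (hM _ (by positivity)) (by positivity)
      rw [Real.norm_eq_abs, show urOverR u y * (cross x y * (cross x y *
        (C ^ 5 * deriv bump (C ^ 2 * ‖y - x‖ ^ 2)))) = (urOverR u y * (cross x y * cross x y)) *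
        (C ^ 5 * deriv bump (C ^ 2 * ‖y - x‖ ^ 2)) by ring, abs_mul]
      calc _ ≤ (‖u y‖ * rad x ^ 2 * rad y) * (C ^ 5 * M) :=
            mul_le_mul (abs_urOverR_mul_le u x y) h2 (abs_nonneg _)
              (mul_nonneg (by positivity) (rad_nonneg y))
        _ ≤ (‖u y‖ * rad x ^ 2 * ((‖x‖ + 1) * c n)) * (C ^ 5 * M) := by gcongr
        _ = _ := by ring
    rw [abs_mul, abs_neg, abs_two, hset, mul_assoc 2]
    refine mul_le_mul_of_nonneg_left (hest.trans ?_) zero_le_two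
    rw [integral_const_mul]
    calc _ ≤ (rad x ^ 2 * ((‖x‖ + 1) * c n) * (C ^ 5 * M)) * (A * c n ^ 3) :=
          mul_le_mul_of_nonneg_left (hA _ (hc n)) (by positivity)
      _ = _ := by rw [hC]; field_simp
  refine squeeze_zero_norm hbound ?_
  simpa using (tendsto_inv_atTop_zero.comp hctop).const_mul (2 * (rad x ^ 2 * (‖x‖ + 1) * M * A))

lemma deriv_deriv_profile_of_lt_half {t : ℝ} (ht : t < 1 / 2) : deriv (deriv profile) t = 0 := by
  have h : ∀ s, s < 1 / 2 → deriv profile s = 0 := fun s hs => by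
    have : profile =ᶠ[𝓝 s] fun _ => 0 := by
      filter_upwards [Iio_mem_nhds hs] with z hz using profile_of_le_half (le_of_lt hz)
    rw [this.deriv_eq, deriv_const]
  have : deriv profile =ᶠ[𝓝 t] fun _ => 0 := by
    filter_upwards [Iio_mem_nhds ht] with z hz using h z hz
  rw [this.deriv_eq, deriv_const]

lemma deriv_deriv_profileScaled_bound :
    ∃ M, 0 ≤ M ∧ ∀ c t, 0 < c → 0 < t →
      |deriv (deriv (profileScaled c)) t| ≤ M / (t ^ 2 * Real.sqrt t) := by
  obtain ⟨M, hM0, hM⟩ := deriv_deriv_profile_bound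
  refine ⟨M, hM0, fun c t hc ht => ?_⟩
  have hs := Real.sqrt_pos.2 ht
  rw [deriv_deriv_profileScaled, abs_mul, abs_of_pos (pow_pos hc 5)]
  calc _ ≤ c ^ 5 * (M / ((c ^ 2 * t) ^ 2 * Real.sqrt (c ^ 2 * t))) :=
        mul_le_mul_of_nonneg_left (hM _ (by positivity)) (by positivity)
    _ = _ := by
        rw [Real.sqrt_mul (by positivity), Real.sqrt_sq hc.le]
        field_simp

lemma cross_sub_self (x y : E3) : cross x (y - x) = cross x y := by
  simp [cross]; ring

/-- The kernel of the representation is dominated by `|x - y|⁻²`. -/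
lemma abs_vertical_mul_cross_sq_le (x y : E3) :
    |(x 2 - y 2) * cross x y ^ 2| ≤ rad x ^ 2 * ‖y - x‖ ^ 3 := by
  have h1 : |x 2 - y 2| ≤ ‖y - x‖ := by
    rw [abs_sub_comm]; simpa using abs_coord_le (y - x) 2
  have h2 : |cross x y| ≤ rad x * ‖y - x‖ := by
    rw [← cross_sub_self]
    exact (abs_cross_le _ _).trans (mul_le_mul_of_nonneg_left (rad_le_norm _) (rad_nonneg _))
  rw [abs_mul, abs_pow]
  calc _ ≤ ‖y - x‖ * (rad x * ‖y - x‖) ^ 2 := by gcongr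
    _ = _ := by ring

/-- The representation formula, at every Lebesgue point of `u` where the convolution of `|x|⁻²` with
`|ω_θ / r|` converges. -/
lemma hdot_eq_integral {u ω : E3 → E3} {p : ℝ≥0∞} (hp : 1 ≤ p)
    (hu : MemLp u p volume) (haxi : IsAxisymmetric u) (hns : NoSwirl u) (hdiv : WeakDivFree u)
    (hcurl : IsWeakCurl u ω) (hf : LocallyIntegrable (omegaOverR ω) volume) {x : E3}
    (hL : Tendsto (fun n : ℕ => ⨍ y in Metric.closedBall x ((n : ℝ) + 2)⁻¹, ‖u y - u x‖)
      atTop (𝓝 0))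
    (hconv : Integrable (fun y => |omegaOverR ω y| / ‖y - x‖ ^ 2) volume) :
    hdot x (u x) = 3 / (4 * Real.pi) *
      ∫ y, omegaOverR ω y * ((x 2 - y 2) * cross x y ^ 2 / ‖y - x‖ ^ 5) := by
  have hul := hu.locallyIntegrable hp
  have hpi := Real.pi_pos
  -- The scales are `1 / c n` and `c n`; the offset `2` keeps them on either side of `1`.
  set c : ℕ → ℝ := fun n => (n : ℝ) + 2 with hcdef
  have hc1 : ∀ n, 1 < c n := fun n => by
    have : (0 : ℝ) ≤ n := Nat.cast_nonneg n
    simp only [hcdef]; linarith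
  have hc0 : ∀ n, 0 < c n := fun n => one_pos.trans (hc1 n)
  have hctop : Tendsto c atTop atTop := tendsto_natCast_atTop_atTop.atTop_add tendsto_const_nhds
  set Φ : ℕ → ℝ → ℝ := fun n t => profileScaled (c n) t - profileScaled (c n)⁻¹ t with hΦdef
  have hΦs : ∀ n, ContDiff ℝ (⊤ : ℕ∞) (Φ n) := fun n =>
    (contDiff_profileScaled _).sub (contDiff_profileScaled _)
  have hΦT : ∀ n t, c n ^ 2 < t → Φ n t = 0 := fun n t ht => by
    have h1 : 1 ≤ c n ^ 2 * t := by nlinarith [hc1 n, one_le_pow₀ (hc1 n).le (n := 2)]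
    have h2 : 1 ≤ (c n)⁻¹ ^ 2 * t := by
      rw [inv_pow, inv_mul_eq_div, one_le_div (pow_pos (hc0 n) 2)]; exact ht.le
    simp only [hΦdef]
    rw [profileScaled_of_le (hc0 n) h1, profileScaled_of_le (inv_pos.2 (hc0 n)) h2, sub_self]
  have hd1 : ∀ n, deriv (Φ n) =
      fun t => deriv (profileScaled (c n)) t - deriv (profileScaled (c n)⁻¹) t := fun n => by
    funext t
    exact deriv_fun_sub ((contDiff_profileScaled _).differentiable (by simp) t)
      ((contDiff_profileScaled _).differentiable (by simp) t)
  have hd2 : ∀ n t, deriv (deriv (Φ n)) t =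
      deriv (deriv (profileScaled (c n))) t - deriv (deriv (profileScaled (c n)⁻¹)) t :=
    fun n t => by
      rw [hd1]
      exact deriv_fun_sub
        ((contDiff_deriv_top (contDiff_profileScaled _)).differentiable (by simp) t)
        ((contDiff_deriv_top (contDiff_profileScaled _)).differentiable (by simp) t)
  have hbumpc := contDiff_bump.continuous
  have hid : ∀ n, (∫ y, hdot x (u y) * (c n ^ 3 * bump (c n ^ 2 * ‖y - x‖ ^ 2))) -
      (∫ y, hdot x (u y) * ((c n)⁻¹ ^ 3 * bump ((c n)⁻¹ ^ 2 * ‖y - x‖ ^ 2))) =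
      4 * ∫ y, omegaOverR ω y *
        ((x 2 - y 2) * cross x y ^ 2 * deriv (deriv (Φ n)) (‖y - x‖ ^ 2)) := fun n => by
    rw [← integral_hdot_eq_integral_omegaOverR hul haxi hdiv hcurl hf (hΦs n) (hΦT n) x,
      ← integral_neg, ← integral_sub]
    · refine integral_congr_ae (Eventually.of_forall fun y => ?_)
      simp only [hd2, deriv_deriv_profileScaled, bump]
      simp only [hd1, deriv_profileScaled]
      ring
    · refine integrable_mul_of_support (locallyIntegrable_hdot hul x) (by fun_prop)
        (T := (c n)⁻¹ ^ 2) (x := x) fun y hy => ?_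
      rw [bump_scaled_eq_zero (hc0 n) hy, mul_zero]
    · refine integrable_mul_of_support (locallyIntegrable_hdot hul x) (by fun_prop)
        (T := (c n)⁻¹⁻¹ ^ 2) (x := x) fun y hy => ?_
      rw [bump_scaled_eq_zero (inv_pos.2 (hc0 n)) hy, mul_zero]
  have hlim1 := (tendsto_integral_bump_near hul hc0 hL).sub
    (tendsto_integral_bump_far hp hu haxi hns x (fun n => (hc1 n).le) hctop)
  simp only [hid, sub_zero] at hlim1
  obtain ⟨M, hM0, hM⟩ := deriv_deriv_profileScaled_bound
  have hlim2 : Tendsto (fun n => ∫ y, omegaOverR ω y *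
        ((x 2 - y 2) * cross x y ^ 2 * deriv (deriv (Φ n)) (‖y - x‖ ^ 2))) atTop
      (𝓝 (∫ y, 3 / (16 * Real.pi) *
        (omegaOverR ω y * ((x 2 - y 2) * cross x y ^ 2 / ‖y - x‖ ^ 5)))) := by
    refine tendsto_integral_of_dominated_convergence
      (fun y => (2 * M * rad x ^ 2) * (|omegaOverR ω y| / ‖y - x‖ ^ 2)) (fun n => ?_)
      (hconv.const_mul _) (fun n => Eventually.of_forall fun y => ?_)
      (Eventually.of_forall fun y => ?_)
    · have h2 : Continuous (deriv (deriv (Φ n))) :=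
        (contDiff_deriv_top (contDiff_deriv_top (hΦs n))).continuous
      exact hf.aestronglyMeasurable.mul (by fun_prop : Continuous _).aestronglyMeasurable
    · rcases eq_or_ne y x with rfl | hyx
      · simp
      have hD : 0 < ‖y - x‖ := norm_pos_iff.2 (sub_ne_zero.2 hyx)
      have h1 : |deriv (deriv (Φ n)) (‖y - x‖ ^ 2)| ≤ 2 * (M / ‖y - x‖ ^ 5) := by
        have e : (‖y - x‖ ^ 2) ^ 2 * Real.sqrt (‖y - x‖ ^ 2) = ‖y - x‖ ^ 5 := by
          rw [Real.sqrt_sq hD.le]; ring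
        have k1 := hM (c n) (‖y - x‖ ^ 2) (hc0 n) (by positivity)
        have k2 := hM (c n)⁻¹ (‖y - x‖ ^ 2) (inv_pos.2 (hc0 n)) (by positivity)
        rw [e] at k1 k2
        rw [hd2, two_mul]
        exact (abs_sub _ _).trans (add_le_add k1 k2)
      rw [Real.norm_eq_abs, abs_mul, abs_mul]
      calc _ ≤ |omegaOverR ω y| * ((rad x ^ 2 * ‖y - x‖ ^ 3) * (2 * (M / ‖y - x‖ ^ 5))) := by
            gcongr
            exact abs_vertical_mul_cross_sq_le x y
        _ = _ := by field_simp
    · rcases eq_or_ne y x with rfl | hyx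
      · simp
      have hD : 0 < ‖y - x‖ := norm_pos_iff.2 (sub_ne_zero.2 hyx)
      have hev : ∀ᶠ n in atTop, 3 / (16 * Real.pi) *
          (omegaOverR ω y * ((x 2 - y 2) * cross x y ^ 2 / ‖y - x‖ ^ 5)) = omegaOverR ω y *
          ((x 2 - y 2) * cross x y ^ 2 * deriv (deriv (Φ n)) (‖y - x‖ ^ 2)) := by
        filter_upwards [hctop.eventually_gt_atTop (‖y - x‖)⁻¹,
          hctop.eventually_gt_atTop (2 * ‖y - x‖)] with n hn1 hn2
        have hcn := hc0 n
        have h1 : 1 < c n ^ 2 * ‖y - x‖ ^ 2 := by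
          rw [← mul_pow]
          exact one_lt_pow₀ ((inv_lt_iff_one_lt_mul₀ hD).1 hn1) two_ne_zero
        have h2 : (c n)⁻¹ ^ 2 * ‖y - x‖ ^ 2 < 1 / 2 := by
          rw [inv_pow, inv_mul_eq_div, div_lt_iff₀ (by positivity)]
          nlinarith
        rw [hd2, deriv_deriv_profileScaled, deriv_deriv_profileScaled,
          deriv_deriv_profile_of_lt_half h2, deriv_deriv_profile h1,
          Real.sqrt_mul (by positivity), Real.sqrt_sq hcn.le, Real.sqrt_sq hD.le]
        field_simp
        ring
      exact tendsto_const_nhds.congr' hev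
  have := tendsto_nhds_unique hlim1 (hlim2.const_mul 4)
  rw [this, integral_const_mul]
  ring

/-! ### Convergence of the convolution integrals -/

lemma integrableOn_ball_kerSY (R : ℝ) :
    IntegrableOn (fun y : E3 => 1 / ‖y‖ ^ 2) (Metric.ball 0 R) volume := by
  rw [← integrable_indicator_iff Metric.isOpen_ball.measurableSet]
  have h : (Metric.ball (0 : E3) R).indicator (fun y : E3 => 1 / ‖y‖ ^ 2) =
      fun y => (Set.Iio R).indicator (fun r : ℝ => 1 / r ^ 2) ‖y‖ := by
    funext y
    simp only [Set.indicator, mem_ball_zero_iff, Set.mem_Iio]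
  rw [h, integrable_fun_norm_addHaar (μ := (volume : Measure E3))
    (f := (Set.Iio R).indicator fun r : ℝ => 1 / r ^ 2)]
  have hdim : Module.finrank ℝ E3 = 3 := by simp
  rw [hdim]
  have h2 : IntegrableOn (fun r : ℝ => (Set.Iio R).indicator (fun _ => (1 : ℝ)) r) (Set.Ioi 0)
      volume := by
    rw [IntegrableOn, integrable_indicator_iff measurableSet_Iio, IntegrableOn,
      Measure.restrict_restrict measurableSet_Iio]
    refine integrableOn_const (s := Set.Iio R ∩ Set.Ioi 0) (ne_of_lt ?_)
    refine (measure_mono (t := Set.Icc 0 R) fun r hr => ⟨le_of_lt hr.2, le_of_lt hr.1⟩).trans_lt ?_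
    simp
  refine h2.congr_fun (fun r hr => ?_) measurableSet_Ioi
  have hr : r ≠ 0 := ne_of_gt hr
  simp only [Set.indicator]
  split_ifs
  · simp [hr]
  · simp

lemma memLp_one_add_norm {q' : ℝ≥0∞} (hq' : 3 / 2 < q') :
    MemLp (fun y : E3 => ((1 + ‖y‖) ^ 2)⁻¹) q' volume := by
  have hc : Continuous fun y : E3 => ((1 + ‖y‖) ^ 2)⁻¹ :=
    Continuous.inv₀ (by fun_prop) fun y => by positivity
  rcases eq_or_ne q' ∞ with rfl | hqt
  · refine memLp_top_of_bound hc.aestronglyMeasurable 1 (Eventually.of_forall fun y => ?_)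
    rw [Real.norm_of_nonneg (by positivity)]
    exact inv_le_one_of_one_le₀ (one_le_pow₀ (by linarith [norm_nonneg y]))
  · have hq0 : q' ≠ 0 := (pos_of_gt hq').ne'
    rw [← integrable_norm_rpow_iff hc.aestronglyMeasurable hq0 hqt]
    have h3 : (3 : ℝ) < 2 * q'.toReal := by
      have h : (3 / 2 : ℝ≥0∞).toReal < q'.toReal := (ENNReal.toReal_lt_toReal
        (by simp [ENNReal.div_eq_top]) hqt).2 hq'
      rw [ENNReal.toReal_div] at h
      norm_num at h
      linarith
    refine (integrable_one_add_norm (E := E3) (μ := volume) (r := 2 * q'.toReal)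
      (by simpa using h3)).congr (Eventually.of_forall fun y => ?_)
    have hy : (0 : ℝ) < 1 + ‖y‖ := by positivity
    simp only
    rw [Real.norm_of_nonneg (by positivity), ← Real.rpow_natCast, ← Real.rpow_neg hy.le,
      ← Real.rpow_mul hy.le]
    congr 1
    push_cast; ring

/-- Away from `x` the integral converges by Hölder's inequality, which is where `q < 3` is used. -/
lemma integrableOn_compl_ball {f : E3 → ℝ} {q : ℝ≥0∞} (hq1 : 1 ≤ q) (hq3 : q < 3)
    (hf : MemLp f q volume) (x : E3) {δ : ℝ} (hδ : 0 < δ) :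
    IntegrableOn (fun y => |f y| / ‖y - x‖ ^ 2) (Metric.ball x δ)ᶜ volume := by
  set q' := ENNReal.conjExponent q with hq'def
  have : q.HolderConjugate q' := ENNReal.HolderConjugate.conjExponent hq1
  have hq' : 3 / 2 < q' := by
    -- `1 / q > 1 / 3`, so `1 / q' < 2 / 3`.
    have hinv : q⁻¹ + q'⁻¹ = 1 := ENNReal.HolderConjugate.inv_add_inv_eq_one q q'
    by_contra hle
    rw [not_lt] at hle
    have h1 : (3 / 2 : ℝ≥0∞)⁻¹ ≤ q'⁻¹ := ENNReal.inv_le_inv.2 hle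
    have h2 : (3 : ℝ≥0∞)⁻¹ < q⁻¹ := ENNReal.inv_lt_inv.2 hq3
    have h3 : (3 : ℝ≥0∞)⁻¹ + (3 / 2 : ℝ≥0∞)⁻¹ < q⁻¹ + q'⁻¹ := by
      refine ENNReal.add_lt_add_of_lt_of_le ?_ h2 h1
      simp [ENNReal.inv_eq_top, ENNReal.div_eq_zero_iff]
    rw [hinv] at h3
    have h4 : (3 : ℝ≥0∞)⁻¹ + (3 / 2 : ℝ≥0∞)⁻¹ = 1 := by
      rw [ENNReal.inv_div (by simp) (by simp), ← ENNReal.toReal_eq_one_iff,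
        ENNReal.toReal_add (by simp) (by simp [ENNReal.div_eq_top])]
      simp [ENNReal.toReal_div]
      norm_num
    exact lt_irrefl _ (h4 ▸ h3)
  have hK : MemLp (fun y : E3 => ((1 + ‖y - x‖) ^ 2)⁻¹) q' volume :=
    (memLp_one_add_norm hq').comp_measurePreserving (measurePreserving_sub_right volume x)
  have hint : Integrable (fun y => ‖f y‖ * ((1 + ‖y - x‖) ^ 2)⁻¹) volume :=
    MemLp.integrable_mul hf.norm hK
  refine Integrable.mono' (g := fun y => ((1 + δ) / δ) ^ 2 * (‖f y‖ * ((1 + ‖y - x‖) ^ 2)⁻¹))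
    (hint.const_mul _).integrableOn ?_ ?_
  · have h1 : AEMeasurable (fun y => |f y|) volume := hf.1.norm.aemeasurable
    have h2 : Measurable fun y : E3 => ‖y - x‖ ^ 2 := by fun_prop
    exact (h1.div h2.aemeasurable).aestronglyMeasurable.restrict
  · refine (ae_restrict_iff' Metric.isOpen_ball.measurableSet.compl).2
      (Eventually.of_forall fun y hy => ?_)
    have hd : δ ≤ ‖y - x‖ := by
      rwa [Set.mem_compl_iff, mem_ball_iff_norm, not_lt] at hy
    have hpos : 0 < ‖y - x‖ := hδ.trans_le hd
    rw [Real.norm_of_nonneg (by positivity), ← Real.norm_eq_abs, div_eq_mul_inv, mul_left_comm]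
    refine mul_le_mul_of_nonneg_left ?_ (norm_nonneg _)
    rw [← inv_div, inv_pow, ← mul_inv, ← mul_pow]
    refine inv_anti₀ (by positivity) (pow_le_pow_left₀ (by positivity) ?_ 2)
    rw [div_mul_eq_mul_div, div_le_iff₀ (by linarith)]
    nlinarith

lemma ae_integrableOn_ball {f : E3 → ℝ} (hf : LocallyIntegrable f volume) :
    ∀ᵐ x ∂(volume : Measure E3),
      IntegrableOn (fun y => |f y| / ‖y - x‖ ^ 2) (Metric.ball x 1) volume := by
  set K : E3 → ℝ := (Metric.ball 0 1).indicator fun y => 1 / ‖y‖ ^ 2 with hK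
  have hKi : Integrable K volume :=
    (integrable_indicator_iff Metric.isOpen_ball.measurableSet).2 (integrableOn_ball_kerSY 1)
  have hN : ∀ N : ℕ, ∀ᵐ x ∂(volume : Measure E3), ConvolutionExistsAt K
      ((Metric.ball 0 ((N : ℝ) + 1)).indicator f) x (ContinuousLinearMap.mul ℝ ℝ) volume :=
    fun N => by
      refine hKi.ae_convolution_exists _ ?_
      rw [integrable_indicator_iff Metric.isOpen_ball.measurableSet]
      exact (hf.integrableOn_isCompact (isCompact_closedBall (0 : E3) _)).mono_set
        Metric.ball_subset_closedBall
  filter_upwards [ae_all_iff.2 hN] with x hx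
  obtain ⟨N, hxN⟩ := exists_nat_gt ‖x‖
  have h1 : Integrable (fun t => K t * (Metric.ball 0 ((N : ℝ) + 1)).indicator f (x - t)) volume :=
    hx N
  have h2 := (h1.comp_sub_left x).norm
  rw [← integrable_indicator_iff Metric.isOpen_ball.measurableSet]
  refine h2.congr (Eventually.of_forall fun y => ?_)
  simp only [hK, sub_sub_cancel]
  by_cases hy : y ∈ Metric.ball x 1
  · have hy' : ‖x - y‖ < 1 := by rwa [mem_ball_iff_norm'] at hy
    have hyN : y ∈ Metric.ball (0 : E3) ((N : ℝ) + 1) := by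
      rw [mem_ball_zero_iff]
      calc ‖y‖ = ‖x - (x - y)‖ := by rw [sub_sub_cancel]
        _ ≤ ‖x‖ + ‖x - y‖ := norm_sub_le _ _
        _ < _ := by linarith
    rw [Set.indicator_of_mem hy, Set.indicator_of_mem hyN,
      Set.indicator_of_mem (by rwa [mem_ball_zero_iff]), norm_mul, norm_sub_rev x y]
    simp [div_eq_inv_mul]
  · have hy' : x - y ∉ Metric.ball (0 : E3) 1 := by
      rwa [mem_ball_zero_iff, ← mem_ball_iff_norm']
    rw [Set.indicator_of_notMem hy, Set.indicator_of_notMem hy', zero_mul, norm_zero]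

lemma integrableOn_ball_of_bounded {f : E3 → ℝ} (hf : AEStronglyMeasurable f volume) {x : E3}
    {δ B : ℝ} (hB : ∀ᵐ y ∂(volume : Measure E3), y ∈ Metric.ball x δ → |f y| ≤ B) :
    IntegrableOn (fun y => |f y| / ‖y - x‖ ^ 2) (Metric.ball x δ) volume := by
  have h0 : IntegrableOn (fun y : E3 => 1 / ‖y - x‖ ^ 2) (Metric.ball x δ) volume := by
    have h := (integrable_indicator_iff Metric.isOpen_ball.measurableSet).2
      (integrableOn_ball_kerSY δ)
    rw [← integrable_indicator_iff Metric.isOpen_ball.measurableSet]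
    refine (h.comp_sub_right x).congr (Eventually.of_forall fun y => ?_)
    simp [Set.indicator, dist_eq_norm]
  refine Integrable.mono' (h0.const_mul B) ?_ ?_
  · have h1 : AEMeasurable (fun y => |f y|) volume := hf.norm.aemeasurable
    have h2 : Measurable fun y : E3 => ‖y - x‖ ^ 2 := by fun_prop
    exact (h1.div h2.aemeasurable).aestronglyMeasurable.restrict
  · rw [ae_restrict_iff' Metric.isOpen_ball.measurableSet]
    filter_upwards [hB] with y hy hyb
    rw [Real.norm_of_nonneg (by positivity), mul_one_div]
    exact div_le_div_of_nonneg_right (hy hyb) (by positivity)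

/-! ### Continuously differentiable velocities -/

lemma continuous_pd {f : E3 → ℝ} (hf : ContDiff ℝ 1 f) (i : Fin 3) : Continuous (pd i f) :=
  (hf.continuous_fderiv one_ne_zero).clm_apply continuous_const

lemma integral_mul_pd {f g : E3 → ℝ} (hf : ContDiff ℝ 1 f) (hg : ContDiff ℝ 1 g)
    (hgc : HasCompactSupport g) (i : Fin 3) :
    Integrable (fun x => f x * pd i g x) volume ∧ Integrable (fun x => pd i f x * g x) volume ∧
      ∫ x, f x * pd i g x = -∫ x, pd i f x * g x := by
  have hpc : HasCompactSupport (pd i g) :=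
    (hgc.fderiv ℝ).comp_left (g := fun A : E3 →L[ℝ] ℝ => A (EuclideanSpace.single i 1)) rfl
  have h1 : Integrable (fun x => f x * pd i g x) volume :=
    (hf.continuous.mul (continuous_pd hg i)).integrable_of_hasCompactSupport hpc.mul_left
  have h2 : Integrable (fun x => pd i f x * g x) volume :=
    ((continuous_pd hf i).mul hg.continuous).integrable_of_hasCompactSupport hgc.mul_left
  have h3 : Integrable (fun x => f x * g x) volume :=
    (hf.continuous.mul hg.continuous).integrable_of_hasCompactSupport hgc.mul_left
  exact ⟨h1, h2, integral_mul_fderiv_eq_neg_fderiv_mul_of_integrable h2 h1 h3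
    (fun x _ => hf.differentiable one_ne_zero x) fun x _ => hg.differentiable one_ne_zero x⟩

lemma contDiff_coord {n : WithTop ℕ∞} {u : E3 → E3} (hu : ContDiff ℝ n u) (i : Fin 3) :
    ContDiff ℝ n fun x => u x i := by fun_prop

lemma continuous_curl_coord {u : E3 → E3} (hu : ContDiff ℝ 1 u) (i : Fin 3) :
    Continuous fun x => curl u x i := by
  have h := fun j k => continuous_pd (contDiff_coord hu j) k
  fin_cases i
  · exact (h 2 1).sub (h 1 2)
  · exact (h 0 2).sub (h 2 0)
  · exact (h 1 0).sub (h 0 1)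

/-- For a `C¹` field the weak curl is the classical one. -/
lemma IsWeakCurl.ae_eq_curl {u ω : E3 → E3} (hu : ContDiff ℝ 1 u) (h : IsWeakCurl u ω) :
    ω =ᵐ[volume] curl u := by
  have hcc : Continuous (curl u) :=
    (PiLp.continuous_toLp 2 _).comp (continuous_pi fun i => continuous_curl_coord hu i)
  refine ae_eq_of_integral_inner_eq h.1 hcc.locallyIntegrable fun ψ hψ hψc => ?_
  rw [← h.2 ψ hψ hψc]
  have hψ1 : ContDiff ℝ 1 ψ := hψ.of_le (by simp)
  have key := fun j k i => integral_mul_pd (contDiff_coord hu j) (contDiff_coord hψ1 k)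
    (hψc.comp_left (g := fun v : E3 => v k) rfl) i
  have e1 : ∀ x, inner ℝ (u x) (curl ψ x) =
      ((u x 0 * pd 1 (fun y => ψ y 2) x - u x 0 * pd 2 (fun y => ψ y 1) x) +
      (u x 1 * pd 2 (fun y => ψ y 0) x - u x 1 * pd 0 (fun y => ψ y 2) x)) +
      (u x 2 * pd 0 (fun y => ψ y 1) x - u x 2 * pd 1 (fun y => ψ y 0) x) := fun x => by
    rw [inner_eq]; simp only [curl]; simp; ring
  have e2 : ∀ x, inner ℝ (curl u x) (ψ x) =
      ((pd 1 (fun y => u y 2) x * ψ x 0 - pd 2 (fun y => u y 1) x * ψ x 0) +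
      (pd 2 (fun y => u y 0) x * ψ x 1 - pd 0 (fun y => u y 2) x * ψ x 1)) +
      (pd 0 (fun y => u y 1) x * ψ x 2 - pd 1 (fun y => u y 0) x * ψ x 2) := fun x => by
    rw [inner_eq]; simp only [curl]; simp; ring
  simp only [e1, e2]
  have split : ∀ {a b c d e f : E3 → ℝ}, Integrable a volume → Integrable b volume →
      Integrable c volume → Integrable d volume → Integrable e volume → Integrable f volume →
      ∫ x, ((a x - b x) + (c x - d x)) + (e x - f x) = ((∫ x, a x) - (∫ x, b x)) +
        ((∫ x, c x) - (∫ x, d x)) + ((∫ x, e x) - (∫ x, f x)) := by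
    intro a b c d e f ha hb hc hd he hf
    have h1 : Integrable (fun x => a x - b x) volume := ha.sub hb
    have h2 : Integrable (fun x => c x - d x) volume := hc.sub hd
    have h3 : Integrable (fun x => e x - f x) volume := he.sub hf
    have h4 : Integrable (fun x => (a x - b x) + (c x - d x)) volume := h1.add h2
    rw [integral_add h4 h3, integral_add h1 h2, integral_sub ha hb, integral_sub hc hd,
      integral_sub he hf]
  rw [split (key 0 2 1).1 (key 0 1 2).1 (key 1 0 2).1 (key 1 2 0).1 (key 2 1 0).1 (key 2 0 1).1,
    split (key 2 0 1).2.1 (key 1 0 2).2.1 (key 0 1 2).2.1 (key 2 1 0).2.1 (key 1 2 0).2.1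
      (key 0 2 1).2.1,
    (key 0 2 1).2.2, (key 0 1 2).2.2, (key 1 0 2).2.2, (key 1 2 0).2.2, (key 2 1 0).2.2,
    (key 2 0 1).2.2]
  ring

lemma exists_ae_bound_omegaOverR {u ω : E3 → E3} (hu : ContDiff ℝ 1 u) (h : IsWeakCurl u ω)
    {x : E3} (hx : 0 < rad x) :
    ∃ δ B, 0 < δ ∧ ∀ᵐ y ∂(volume : Measure E3), y ∈ Metric.ball x δ → |omegaOverR ω y| ≤ B := by
  have hca : ContinuousAt (omegaOverR (curl u)) x := by
    rw [show omegaOverR (curl u) = fun y => (y 0 * curl u y 1 - y 1 * curl u y 0) / rad y ^ 2 from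
      funext (omegaOverR_eq _)]
    have h0 := continuous_curl_coord hu 0
    have h1 := continuous_curl_coord hu 1
    have c0 : Continuous fun y : E3 => y 0 := by fun_prop
    have c1 : Continuous fun y : E3 => y 1 := by fun_prop
    exact ((c0.mul h1).sub (c1.mul h0)).continuousAt.div (continuous_rad.pow 2).continuousAt
      (pow_pos hx 2).ne'
  have hlt : ∀ᶠ y in 𝓝 x, |omegaOverR (curl u) y| < |omegaOverR (curl u) x| + 1 :=
    hca.abs.eventually_lt continuousAt_const (lt_add_one _)
  obtain ⟨δ, hδ, hball⟩ := Metric.eventually_nhds_iff_ball.1 hlt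
  refine ⟨δ, |omegaOverR (curl u) x| + 1, hδ, ?_⟩
  filter_upwards [h.ae_eq_curl hu] with y hy hyb
  rw [show omegaOverR ω y = omegaOverR (curl u) y by rw [omegaOverR, hy, ← omegaOverR]]
  exact (hball y hyb).le

lemma tendsto_average_of_continuousAt {u : E3 → E3} {x : E3} (hu : Continuous u)
    {r : ℕ → ℝ} (hr : ∀ n, 0 < r n) (hr0 : Tendsto r atTop (𝓝 0)) :
    Tendsto (fun n => ⨍ y in Metric.closedBall x (r n), ‖u y - u x‖) atTop (𝓝 0) := by
  rw [Metric.tendsto_nhds]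
  intro ε hε
  obtain ⟨δ, hδ, hball⟩ :=
    Metric.continuousAt_iff.1 (hu.continuousAt (x := x)) (ε / 2) (by positivity)
  filter_upwards [hr0.eventually_lt_const hδ] with n hn
  have hfin : volume (Metric.closedBall x (r n)) ≠ ∞ :=
    (isCompact_closedBall x (r n)).measure_lt_top.ne
  have hV : 0 < (volume : Measure E3).real (Metric.closedBall x (r n)) := by
    rw [volume_real_closedBall x (hr n).le]
    have := hr n
    positivity
  rw [Real.dist_0_eq_abs, setAverage_eq, smul_eq_mul, abs_mul, abs_of_pos (inv_pos.2 hV),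
    inv_mul_lt_iff₀ hV, ← Real.norm_eq_abs]
  have hle := norm_setIntegral_le_of_norm_le_const (μ := volume) (C := ε / 2)
    (f := fun y => ‖u y - u x‖) hfin.lt_top fun y hy => by
      rw [norm_norm, ← dist_eq_norm]
      exact (hball ((Metric.mem_closedBall.1 hy).trans_lt hn)).le
  nlinarith

/-! ### The convolution formula -/

lemma abs_ker0_le (t : E3) : |ker0 t| ≤ kerSY t := by
  rcases eq_or_ne t 0 with rfl | ht
  · simp [ker0, kerSY]
  have h := norm_pos_iff.2 ht
  rw [ker0, kerSY, abs_div, abs_of_pos (pow_pos h 3),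
    div_le_div_iff₀ (by positivity) (by positivity)]
  have := abs_coord_le t 2
  calc |t 2| * ‖t‖ ^ 2 ≤ ‖t‖ * ‖t‖ ^ 2 := by gcongr
    _ = 1 * ‖t‖ ^ 3 := by ring

lemma abs_ker_le (i j : Fin 3) (t : E3) : |ker i j t| ≤ kerSY t := by
  rcases eq_or_ne t 0 with rfl | ht
  · simp [ker, kerSY]
  have h := norm_pos_iff.2 ht
  rw [ker, kerSY, abs_div, abs_of_pos (pow_pos h 5),
    div_le_div_iff₀ (by positivity) (by positivity), abs_mul, abs_mul]
  have hi := abs_coord_le t i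
  have hj := abs_coord_le t j
  have h2 := abs_coord_le t 2
  calc |t i| * |t j| * |t 2| * ‖t‖ ^ 2 ≤ ‖t‖ * ‖t‖ * ‖t‖ * ‖t‖ ^ 2 := by gcongr
    _ = 1 * ‖t‖ ^ 5 := by ring

lemma convExists_of_abs_le {K f g : E3 → ℝ} {x : E3} (hK : Measurable K)
    (hKle : ∀ t, |K t| ≤ kerSY t) (hg : AEStronglyMeasurable g volume)
    (hgf : ∀ y, |g y| = |f y|)
    (hint : Integrable (fun y => |f y| / ‖y - x‖ ^ 2) volume) : ConvExists K g x := by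
  have h1 := hint.comp_sub_left x
  refine h1.mono' ?_ (Eventually.of_forall fun t => ?_)
  · have h2 : AEStronglyMeasurable (fun t => g (x - t)) volume :=
      hg.comp_measurePreserving (Measure.measurePreserving_sub_left volume x)
    exact hK.aestronglyMeasurable.mul h2
  · simp only [ContinuousLinearMap.mul_apply', sub_sub_cancel_left, norm_neg, norm_mul,
      Real.norm_eq_abs, hgf]
    calc |K t| * |f (x - t)| ≤ kerSY t * |f (x - t)| := by gcongr; exact hKle t
      _ = _ := by rw [kerSY, one_div_mul_eq_div]

lemma ConvExists.integrable {K f : E3 → ℝ} {x : E3} (h : ConvExists K f x) :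
    Integrable (fun y => K (x - y) * f y) volume := by
  have h1 : Integrable (fun t => K t * f (x - t)) volume := h
  simpa using h1.comp_sub_left x

lemma conv_eq_integral (K f : E3 → ℝ) (x : E3) : conv K f x = ∫ y, K (x - y) * f y := by
  have h := integral_sub_left_eq_self (fun y => K (x - y) * f y) (volume : Measure E3) x
  simp only [sub_sub_cancel] at h
  rw [← h]
  rfl

lemma gamma1_eq : gamma1 = Complex.I / (8 * Real.pi) := by
  have h : (((2 * Real.pi) ^ 3)⁻¹ *
      (Real.pi ^ (3 / 2 : ℝ) * Real.Gamma (1 / 2) / Real.Gamma 2) : ℝ) = 1 / (8 * Real.pi) := by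
    have hpi := Real.pi_pos
    have hp : Real.pi ^ (3 / 2 : ℝ) * Real.sqrt Real.pi = Real.pi ^ 2 := by
      rw [Real.sqrt_eq_rpow, ← Real.rpow_add hpi]; norm_num
    rw [Real.Gamma_one_half_eq, Real.Gamma_two, div_one, hp]
    field_simp
    norm_num
  rw [gamma1, h]
  push_cast
  ring

lemma c1_add_two_gamma1 : c1 + 2 * gamma1 * Complex.I = 0 := by
  have h : c1 = 1 / (4 * Real.pi) := by
    have h' : (((2 * Real.pi) ^ 3)⁻¹ *
        (2 * Real.pi ^ (3 / 2 : ℝ) * Real.Gamma (1 / 2) / Real.Gamma 1) : ℝ) =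
        1 / (4 * Real.pi) := by
      have hpi := Real.pi_pos
      have hp : Real.pi ^ (3 / 2 : ℝ) * Real.sqrt Real.pi = Real.pi ^ 2 := by
        rw [Real.sqrt_eq_rpow, ← Real.rpow_add hpi]; norm_num
      rw [Real.Gamma_one_half_eq, Real.Gamma_one, div_one, mul_assoc 2, hp]
      field_simp
      norm_num
    rw [c1, h']
    push_cast
    ring
  have hpi : (Real.pi : ℂ) ≠ 0 := by exact_mod_cast Real.pi_ne_zero
  rw [h, gamma1_eq]
  field_simp
  rw [Complex.I_sq]
  norm_num

/-- The kernel of the angular representation, expanded into the three kernels of the formula. -/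
lemma vertical_mul_cross_sq_div (x y : E3) :
    (x 2 - y 2) * cross x y ^ 2 / ‖y - x‖ ^ 5 = x 1 ^ 2 * ker 0 0 (x - y) +
      x 0 ^ 2 * ker 1 1 (x - y) - 2 * (x 0 * x 1) * ker 0 1 (x - y) := by
  simp only [ker, cross, norm_sub_rev y x, PiLp.sub_apply]
  ring

lemma formulaAt_and_syBoundAt {u ω : E3 → E3} {x : E3} (hx : 0 < rad x)
    (hf : LocallyIntegrable (omegaOverR ω) volume)
    (hint : Integrable (fun y => |omegaOverR ω y| / ‖y - x‖ ^ 2) volume)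
    (hrep : hdot x (u x) = 3 / (4 * Real.pi) *
      ∫ y, omegaOverR ω y * ((x 2 - y 2) * cross x y ^ 2 / ‖y - x‖ ^ 5)) :
    FormulaAt u ω x ∧ SYBoundAt (3 / (4 * Real.pi)) u ω x := by
  have hpi := Real.pi_pos
  have hm := hf.aestronglyMeasurable
  have hk0 : Measurable ker0 := by unfold ker0; fun_prop
  have hk : ∀ i j, Measurable (ker i j) := fun i j => by unfold ker; fun_prop
  have hkS : Measurable kerSY := by unfold kerSY; fun_prop
  have hC0 : ConvExists ker0 (omegaOverR ω) x :=
    convExists_of_abs_le hk0 abs_ker0_le hm (fun _ => rfl) hint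
  have hC : ∀ i j, ConvExists (ker i j) (omegaOverR ω) x := fun i j =>
    convExists_of_abs_le (hk i j) (abs_ker_le i j) hm (fun _ => rfl) hint
  have hCS : ConvExists kerSY (fun y => |omegaOverR ω y|) x :=
    convExists_of_abs_le hkS (fun t => (abs_of_nonneg (by unfold kerSY; positivity)).le) hm.norm
      (fun _ => abs_abs _) hint
  have hur : urOverR u x = hdot x (u x) / rad x ^ 2 := by rw [urOverR_eq, hdot]
  have hexp : ∫ y, omegaOverR ω y * ((x 2 - y 2) * cross x y ^ 2 / ‖y - x‖ ^ 5) =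
      x 1 ^ 2 * conv (ker 0 0) (omegaOverR ω) x + x 0 ^ 2 * conv (ker 1 1) (omegaOverR ω) x -
        2 * (x 0 * x 1) * conv (ker 0 1) (omegaOverR ω) x := by
    have i00 := (hC 0 0).integrable.const_mul (x 1 ^ 2)
    have i11 := (hC 1 1).integrable.const_mul (x 0 ^ 2)
    have i01 := (hC 0 1).integrable.const_mul (2 * (x 0 * x 1))
    have isum : Integrable (fun y => x 1 ^ 2 * (ker 0 0 (x - y) * omegaOverR ω y) +
        x 0 ^ 2 * (ker 1 1 (x - y) * omegaOverR ω y)) volume := i00.add i11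
    simp only [conv_eq_integral]
    rw [← integral_const_mul, ← integral_const_mul, ← integral_const_mul, ← integral_add i00 i11,
      ← integral_sub isum i01]
    refine integral_congr_ae (Eventually.of_forall fun y => ?_)
    simp only [vertical_mul_cross_sq_div]
    ring
  refine ⟨⟨hC0, hC 0 0, hC 1 1, hC 0 1, ?_⟩, hCS, ?_⟩
  · rw [c1_add_two_gamma1, hur, hrep, hexp, gamma1_eq]
    have hpi' : (Real.pi : ℂ) ≠ 0 := by exact_mod_cast Real.pi_ne_zero
    have hx' : (rad x : ℂ) ≠ 0 := by exact_mod_cast hx.ne'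
    push_cast
    field_simp
    rw [Complex.I_sq]
    ring
  · have habs : |∫ y, omegaOverR ω y * ((x 2 - y 2) * cross x y ^ 2 / ‖y - x‖ ^ 5)| ≤
        ∫ y, rad x ^ 2 * (kerSY (x - y) * |omegaOverR ω y|) := by
      rw [← Real.norm_eq_abs]
      refine norm_integral_le_of_norm_le (hCS.integrable.const_mul _)
        (Eventually.of_forall fun y => ?_)
      rcases eq_or_ne y x with rfl | hyx
      · simp [kerSY]
      have hD : 0 < ‖y - x‖ := norm_pos_iff.2 (sub_ne_zero.2 hyx)
      rw [Real.norm_eq_abs, abs_mul, abs_div, abs_of_pos (pow_pos hD 5), kerSY, norm_sub_rev x y]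
      calc _ ≤ |omegaOverR ω y| * (rad x ^ 2 * ‖y - x‖ ^ 3 / ‖y - x‖ ^ 5) := by
            gcongr
            exact abs_vertical_mul_cross_sq_le x y
        _ = _ := by field_simp
    rw [integral_const_mul, ← conv_eq_integral kerSY fun y => |omegaOverR ω y|] at habs
    rw [hur, hrep, abs_div, abs_of_pos (pow_pos hx 2), abs_mul, abs_of_pos (by positivity),
      div_le_iff₀ (pow_pos hx 2), mul_assoc (3 / (4 * Real.pi))]
    refine mul_le_mul_of_nonneg_left ?_ (by positivity)
    rw [mul_comm]
    exact habs

end AxisymFlow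

open AxisymFlow
theorem proposition2p6 :
    ∃ C : ℝ, 0 < C ∧
      ∀ (p q : ℝ≥0∞) (u ω : E3 → E3), 1 ≤ p → 1 ≤ q → q < 3 →
        MemLp u p (volume : Measure E3) →
        IsAxisymmetric u → NoSwirl u → WeakDivFree u → IsWeakCurl u ω →
        MemLp (omegaOverR ω) q (volume : Measure E3) →
        (∀ᵐ x ∂(volume : Measure E3), FormulaAt u ω x ∧ SYBoundAt C u ω x) ∧
        (ContDiff ℝ 1 u → ∀ x : E3, 0 < rad x → FormulaAt u ω x ∧ SYBoundAt C u ω x) := by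
  have hpi := Real.pi_pos
  refine ⟨3 / (4 * Real.pi), by positivity, fun p q u ω hp hq1 hq3 hu haxi hns hdiv hcurl hf => ?_⟩
  have hfl := hf.locallyIntegrable hq1
  have hul := hu.locallyIntegrable hp
  have hr : ∀ n : ℕ, 0 < ((n : ℝ) + 2)⁻¹ := fun n => by positivity
  have hr0 : Filter.Tendsto (fun n : ℕ => ((n : ℝ) + 2)⁻¹) Filter.atTop (nhds 0) :=
    tendsto_inv_atTop_zero.comp (tendsto_natCast_atTop_atTop.atTop_add tendsto_const_nhds)
  have hjoin : ∀ {x : E3} {δ : ℝ}, 0 < δ →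
      IntegrableOn (fun y => |omegaOverR ω y| / ‖y - x‖ ^ 2) (Metric.ball x δ) volume →
      Integrable (fun y => |omegaOverR ω y| / ‖y - x‖ ^ 2) volume := fun {x δ} hδ h => by
    rw [← integrableOn_univ, ← Set.union_compl_self (Metric.ball x δ)]
    exact h.union (integrableOn_compl_ball hq1 hq3 hf x hδ)
  constructor
  · filter_upwards [ae_rad_pos, ae_integrableOn_ball hfl,
      IsUnifLocDoublingMeasure.ae_tendsto_average_norm_sub (volume : Measure E3) hul 1]
      with x hx hxi hxL
    have hint := hjoin one_pos hxi
    refine formulaAt_and_syBoundAt hx hfl hint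
      (hdot_eq_integral hp hu haxi hns hdiv hcurl hfl ?_ hint)
    refine hxL (fun _ => x) (fun n : ℕ => ((n : ℝ) + 2)⁻¹) ?_ (Filter.Eventually.of_forall
      fun n => Metric.mem_closedBall_self (by rw [one_mul]; exact (hr n).le))
    exact tendsto_nhdsWithin_iff.2 ⟨hr0, Filter.Eventually.of_forall hr⟩
  · intro hu1 x hx
    obtain ⟨δ, B, hδ, hB⟩ := exists_ae_bound_omegaOverR hu1 hcurl hx
    have hint := hjoin hδ (integrableOn_ball_of_bounded hfl.aestronglyMeasurable hB)
    exact formulaAt_and_syBoundAt hx hfl hint (hdot_eq_integral hp hu haxi hns hdiv hcurl hfl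
      (tendsto_average_of_continuousAt hu1.continuous hr hr0) hint)
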